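/- For $0\le\alpha,\beta\le\infty$ let $S^\beta_\alpha$ be the Gelfand–Shilov space of all smooth $f:\mathbb R\to\mathbb C$ for which there are constants $C,A,B>0$ with $|x^q f^{(k)}(x)|\le C A^q B^k q^{q\alpha}k^{k\beta}$ for all $x\in\mathbb R$ and $q,k\in\mathbb N_0$ ($0^0=1$); if an index is infinite, the corresponding factor $A^qq^{q\alpha}$ (or $B^kk^{k\beta}$) is replaced by an arbitrary constant depending on $q$ (or $k$). The momentum and position operators of the Schrödinger representation of the Heisenberg algebra act on $S^\beta_\alpha$, in momentum space, by $f(x)\mapsto x f(x)$ and $f\mapsto i f'$. An entire function $J$ is infra-exponential of order $s$ if for every $\varepsilon>0$ there is $C>0$ with $|J(\xi)|\le C e^{\varepsilon|\xi|^{s}}$ for all $\xi\in\mathbb C$. Let $L^2_0(\mathbb R)$ be the set of $f\in L^2(\mathbb R)$ such that for all $k\in\mathbb N_0$ the function $x^kf(x)$ is integrable and $\int x^k f(x)\,dx=0$; let $\mathcal F$ be the Fourier transform on $L^2(\mathbb R)$. A Krein space is a complex vector space $K$ with a non-degenerate hermitian inner product $\langle\cdot,\cdot\rangle$ (antilinear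 in the first argument) that has a fundamental decomposition: $K=K^+\dotplus K^-$ with $K^+\perp K^-$, $K^+$ positive definite and $K^-$ negative definite, where moreover both are complete for the norm $|\langle x,x\rangle|^{1/2}$. Its rank of negativity is the Hilbert space dimension of $K^-$ (the same for all fundamental decompositions). A majorant of an inner product is a locally convex topology for which it is jointly continuous; a majorant is minimal if no majorant is strictly weaker. A maximal Krein space completion of an indefinite inner product space $V$ is a Krein space $K$ whose inner product is jointly continuous for a Hilbert space topology on $K$, together with an isometric linear embedding of $V$ onto a dense subspace of $K$, such that the topology induced on $V$ is a minimal majorant. **Theorem.** Let $0\le\alpha\le\infty$, $1<\beta<\infty$ and $\delta>\beta$. Let $J$ be infra-exponential of order $1/(2\delta)$ with strictly positive Taylor coefficients $c_k^2$ at $0$, where $c_k\in\mathbb R\setminus\{0\}$. Then for $f,g\in V=S^\beta_\alpha$ the integral and the series in $$\langle f,g\rangle=\int_{\mathbb R}\overline{f(x)}\,g(x)\,dx-\sum_{k=0}^\infty c_k^2\,\overline{f^{(k)}(0)}\,g^{(k)}(0)$$ converge, and $V$ with this inner product has a maximal Krein space completion $K$, of countably infinite rank of negativity, with the following property. There is a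 closed subspace $H\subset K$ which is maximal among the positive definite subspaces of $K$, and which is the largest positive definite subspace $W$ of $K$ that is invariant under the Schrödinger representation, acting by symmetric operators; that is, for which $V\cap W$ is dense in $W$ and is mapped to itself by the momentum and the position operator, which are symmetric on it with respect to $\langle\cdot,\cdot\rangle$. Both operators on $V\cap H$ extend to selfadjoint operators in $(H,\langle\cdot,\cdot\rangle)$. The subspace $H$ is the Fourier transform of $L^2_0(\mathbb R)$ in the following sense: $V\cap H=V\cap\mathcal F L^2_0(\mathbb R)$, and there is a continuous linear map $j:L^2(\mathbb R)\to K$ with $\langle ju,jv\rangle=(u,v)_{L^2}$ for all $u,v$, which is the given embedding on $V\cap\mathcal F L^2_0(\mathbb R)$, such that $H$ is the closure of $j(\mathcal F L^2_0(\mathbb R))$ in $K$. -/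

import Mathlib

open MeasureTheory Filter Topology
open scoped ENNReal NNReal Nat ContDiff FourierTransform ComplexConjugate

/-! ## Gelfand-Shilov spaces -/

/-- Admissible growth of a sequence of constants for the Gelfand-Shilov index `s ∈ [0, ∞]`:
`a n ≤ C A ^ n n ^ (n s)` with the convention `0 ^ 0 = 1` if `s < ∞`, and no restriction on the
growth if `s = ∞`. -/
def IsGelfandShilovWeight (s : ℝ≥0∞) (a : ℕ → ℝ) : Prop :=
  (∀ n, 0 ≤ a n) ∧
    (s ≠ ⊤ → ∃ C > 0, ∃ A > 0, ∀ n : ℕ, a n ≤ C * A ^ n * (n : ℝ) ^ ((n : ℝ) * s.toReal))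

/-- Membership in `S^β_α(ℝ)`: smoothness, and `|x ^ q f⁽ᵏ⁾(x)| ≤ a_q b_k` for all `q, k, x`, where
`a` and `b` are admissible for `α` and `β`. For finite `α, β` this is the estimate
`|x ^ q f⁽ᵏ⁾(x)| ≤ C A ^ q B ^ k q ^ (q α) k ^ (k β)`; for an infinite index the dependence of the
constant on `q` or on `k` is arbitrary, so that `S^∞_∞` is the Schwartz space. -/
def IsGelfandShilov (α β : ℝ≥0∞) (f : ℝ → ℂ) : Prop :=
  ContDiff ℝ ∞ f ∧ ∃ a b : ℕ → ℝ, IsGelfandShilovWeight α a ∧ IsGelfandShilovWeight β b ∧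
    ∀ (q k : ℕ) (x : ℝ), ‖(x : ℂ) ^ q * iteratedDeriv k f x‖ ≤ a q * b k

lemma IsGelfandShilovWeight.exists_one_le {s : ℝ≥0∞} {a : ℕ → ℝ}
    (ha : IsGelfandShilovWeight s a) (hs : s ≠ ⊤) :
    ∃ C > 0, ∃ A ≥ 1, ∀ n : ℕ, a n ≤ C * A ^ n * (n : ℝ) ^ ((n : ℝ) * s.toReal) := by
  obtain ⟨C, hC, A, hA, h⟩ := ha.2 hs
  refine ⟨C, hC, max A 1, le_max_right _ _, fun n => (h n).trans ?_⟩
  gcongr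
  exact le_max_left _ _

lemma IsGelfandShilovWeight.add {s : ℝ≥0∞} {a b : ℕ → ℝ}
    (ha : IsGelfandShilovWeight s a) (hb : IsGelfandShilovWeight s b) :
    IsGelfandShilovWeight s (fun n => a n + b n) := by
  refine ⟨fun n => add_nonneg (ha.1 n) (hb.1 n), fun hs => ?_⟩
  obtain ⟨C, hC, A, hA, h⟩ := ha.2 hs
  obtain ⟨C', hC', A', hA', h'⟩ := hb.2 hs
  refine ⟨C + C', by positivity, max A A', lt_max_of_lt_left hA, fun n => ?_⟩
  calc a n + b n ≤ C * A ^ n * (n : ℝ) ^ ((n : ℝ) * s.toReal)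
        + C' * A' ^ n * (n : ℝ) ^ ((n : ℝ) * s.toReal) := add_le_add (h n) (h' n)
    _ ≤ C * (max A A') ^ n * (n : ℝ) ^ ((n : ℝ) * s.toReal)
        + C' * (max A A') ^ n * (n : ℝ) ^ ((n : ℝ) * s.toReal) := by
        gcongr
        · exact le_max_left _ _
        · exact le_max_right _ _
    _ = _ := by ring

lemma IsGelfandShilovWeight.const_mul {s : ℝ≥0∞} {a : ℕ → ℝ}
    (ha : IsGelfandShilovWeight s a) {c : ℝ} (hc : 0 ≤ c) :
    IsGelfandShilovWeight s (fun n => c * a n) := by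
  refine ⟨fun n => mul_nonneg hc (ha.1 n), fun hs => ?_⟩
  obtain ⟨C, hC, A, hA, h⟩ := ha.2 hs
  refine ⟨(c + 1) * C, by positivity, A, hA, fun n => ?_⟩
  have h1 := ha.1 n
  calc c * a n ≤ (c + 1) * a n := by nlinarith
    _ ≤ (c + 1) * (C * A ^ n * (n : ℝ) ^ ((n : ℝ) * s.toReal)) := by gcongr; exact h n
    _ = _ := by ring

lemma succ_rpow_self_le (t : ℝ) (ht : 0 ≤ t) (n : ℕ) :
    ((n + 1 : ℕ) : ℝ) ^ (((n + 1 : ℕ) : ℝ) * t)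
      ≤ ((2 * Real.exp 1) ^ t) ^ n * (n : ℝ) ^ ((n : ℝ) * t) := by
  rcases Nat.eq_zero_or_pos n with rfl | hn
  · simp
  have hn' : (0 : ℝ) < n := by exact_mod_cast hn
  have h1 : ((n + 1 : ℕ) : ℝ) ^ (n + 1) ≤ (2 * Real.exp 1) ^ n * (n : ℝ) ^ n := by
    have e1 : ((n + 1 : ℕ) : ℝ) ^ n ≤ Real.exp 1 * (n : ℝ) ^ n := by
      have h := Real.add_one_le_exp ((n : ℝ)⁻¹)
      have h2 : ((n + 1 : ℕ) : ℝ) = ((n : ℝ)⁻¹ + 1) * n := by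
        push_cast; field_simp; ring
      rw [h2, mul_pow]
      gcongr
      calc ((n : ℝ)⁻¹ + 1) ^ n ≤ (Real.exp ((n : ℝ)⁻¹)) ^ n := by gcongr
        _ = Real.exp 1 := by rw [← Real.exp_nat_mul]; congr 1; field_simp
    have e2 : ((n + 1 : ℕ) : ℝ) ≤ 2 ^ n := by exact_mod_cast Nat.lt_two_pow_self
    have e3 : Real.exp 1 ≤ Real.exp 1 ^ n :=
      le_self_pow₀ (Real.one_le_exp zero_le_one) hn.ne'
    calc ((n + 1 : ℕ) : ℝ) ^ (n + 1) = ((n + 1 : ℕ) : ℝ) ^ n * ((n + 1 : ℕ) : ℝ) := pow_succ _ _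
      _ ≤ (Real.exp 1 ^ n * (n : ℝ) ^ n) * 2 ^ n := by
          gcongr
          exact e1.trans (by gcongr)
      _ = _ := by rw [mul_pow]; ring
  rw [Real.rpow_mul (by positivity), Real.rpow_mul hn'.le, Real.rpow_natCast, Real.rpow_natCast]
  calc (((n + 1 : ℕ) : ℝ) ^ (n + 1)) ^ t ≤ ((2 * Real.exp 1) ^ n * (n : ℝ) ^ n) ^ t :=
        Real.rpow_le_rpow (by positivity) h1 ht
    _ = _ := by
        rw [Real.mul_rpow (by positivity) (by positivity), ← Real.rpow_natCast (2 * Real.exp 1) n,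
          ← Real.rpow_mul (by positivity), mul_comm (n : ℝ) t, Real.rpow_mul (by positivity),
          Real.rpow_natCast]

lemma IsGelfandShilovWeight.shift {s : ℝ≥0∞} {a : ℕ → ℝ} (ha : IsGelfandShilovWeight s a) :
    IsGelfandShilovWeight s (fun n => a (n + 1)) := by
  refine ⟨fun n => ha.1 _, fun hs => ?_⟩
  obtain ⟨C, hC, A, hA, h⟩ := ha.2 hs
  refine ⟨C * A, by positivity, A * (2 * Real.exp 1) ^ s.toReal, by positivity, fun n => ?_⟩
  calc a (n + 1) ≤ C * A ^ (n + 1) * ((n + 1 : ℕ) : ℝ) ^ (((n + 1 : ℕ) : ℝ) * s.toReal) := h _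
    _ ≤ C * A ^ (n + 1) * (((2 * Real.exp 1) ^ s.toReal) ^ n *
          (n : ℝ) ^ ((n : ℝ) * s.toReal)) := by
        gcongr
        exact succ_rpow_self_le _ ENNReal.toReal_nonneg n
    _ = _ := by rw [mul_pow]; ring

lemma IsGelfandShilovWeight.pred {s : ℝ≥0∞} {a : ℕ → ℝ} (ha : IsGelfandShilovWeight s a) :
    IsGelfandShilovWeight s (fun n => n * a (n - 1)) := by
  refine ⟨fun n => mul_nonneg n.cast_nonneg (ha.1 _), fun hs => ?_⟩
  obtain ⟨C, hC, A, hA, h⟩ := ha.exists_one_le hs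
  refine ⟨C, hC, 2 * A, by positivity, fun n => ?_⟩
  rcases n with _ | m
  · simp; positivity
  have e2 : ((m + 1 : ℕ) : ℝ) ≤ 2 ^ (m + 1) := by exact_mod_cast Nat.lt_two_pow_self.le
  have e3 : (m : ℝ) ^ ((m : ℝ) * s.toReal)
      ≤ ((m + 1 : ℕ) : ℝ) ^ (((m + 1 : ℕ) : ℝ) * s.toReal) := by
    have hs0 : 0 ≤ s.toReal := ENNReal.toReal_nonneg
    calc (m : ℝ) ^ ((m : ℝ) * s.toReal) ≤ ((m + 1 : ℕ) : ℝ) ^ ((m : ℝ) * s.toReal) := by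
          apply Real.rpow_le_rpow (by positivity) (by push_cast; linarith) (by positivity)
      _ ≤ _ := by
          apply Real.rpow_le_rpow_of_exponent_le
          · push_cast; linarith [(Nat.cast_nonneg m : (0 : ℝ) ≤ m)]
          · gcongr; omega
  have e4 : A ^ m ≤ A ^ (m + 1) := pow_le_pow_right₀ hA (by omega)
  simp only [Nat.add_sub_cancel]
  calc ((m + 1 : ℕ) : ℝ) * a m
      ≤ 2 ^ (m + 1) * (C * A ^ m * (m : ℝ) ^ ((m : ℝ) * s.toReal)) :=
        mul_le_mul e2 (h m) (ha.1 m) (by positivity)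
    _ ≤ 2 ^ (m + 1) * (C * A ^ (m + 1) *
          ((m + 1 : ℕ) : ℝ) ^ (((m + 1 : ℕ) : ℝ) * s.toReal)) := by gcongr
    _ = _ := by rw [mul_pow]; ring

lemma IsGelfandShilov.add {α β : ℝ≥0∞} {f g : ℝ → ℂ} (hf : IsGelfandShilov α β f)
    (hg : IsGelfandShilov α β g) : IsGelfandShilov α β (f + g) := by
  obtain ⟨hf, a, b, ha, hb, h⟩ := hf
  obtain ⟨hg, a', b', ha', hb', h'⟩ := hg
  refine ⟨hf.add hg, _, _, ha.add ha', hb.add hb', fun q k x => ?_⟩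
  rw [iteratedDeriv_add ((hf.of_le (by exact_mod_cast le_top)).contDiffAt)
    ((hg.of_le (by exact_mod_cast le_top)).contDiffAt), mul_add]
  have h1 := h q k x
  have h2 := h' q k x
  have p1 := mul_nonneg (ha.1 q) (hb'.1 k)
  have p2 := mul_nonneg (ha'.1 q) (hb.1 k)
  calc _ ≤ _ := norm_add_le _ _
    _ ≤ a q * b k + a' q * b' k := add_le_add h1 h2
    _ ≤ _ := by nlinarith

lemma IsGelfandShilov.const_smul {α β : ℝ≥0∞} {f : ℝ → ℂ} (hf : IsGelfandShilov α β f) (c : ℂ) :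
    IsGelfandShilov α β (c • f) := by
  obtain ⟨hf, a, b, ha, hb, h⟩ := hf
  refine ⟨hf.const_smul c, _, b, ha.const_mul (norm_nonneg c), hb, fun q k x => ?_⟩
  rw [iteratedDeriv_const_smul ((hf.of_le (by exact_mod_cast le_top)).contDiffAt), smul_eq_mul,
    mul_left_comm, norm_mul, mul_assoc]
  exact mul_le_mul_of_nonneg_left (h q k x) (norm_nonneg c)

lemma IsGelfandShilov.zero (α β : ℝ≥0∞) : IsGelfandShilov α β 0 := by
  refine ⟨contDiff_const, 0, 0, ⟨fun _ => le_rfl, fun _ => ⟨1, one_pos, 1, one_pos, fun n => ?_⟩⟩,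
    ⟨fun _ => le_rfl, fun _ => ⟨1, one_pos, 1, one_pos, fun n => ?_⟩⟩, fun q k x => ?_⟩
  · simp only [Pi.zero_apply]; positivity
  · simp only [Pi.zero_apply]; positivity
  · have : iteratedDeriv k (0 : ℝ → ℂ) x = 0 := by
      have := iteratedDeriv_const (n := k) (c := (0 : ℂ)) (x := x)
      simp only [ite_self] at this
      exact this
    simp [this]

lemma IsGelfandShilov.deriv {α β : ℝ≥0∞} {f : ℝ → ℂ} (hf : IsGelfandShilov α β f) :
    IsGelfandShilov α β (deriv f) := by
  obtain ⟨hf, a, b, ha, hb, h⟩ := hf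
  refine ⟨(contDiff_infty_iff_deriv.1 hf).2, a, _, ha, hb.shift, fun q k x => ?_⟩
  rw [← iteratedDeriv_succ']
  exact h q (k + 1) x

lemma iteratedDeriv_ofReal_mul {f : ℝ → ℂ} (hf : ContDiff ℝ ∞ f) (k : ℕ) (x : ℝ) :
    iteratedDeriv k (fun y : ℝ => (y : ℂ) * f y) x
      = x * iteratedDeriv k f x + k * iteratedDeriv (k - 1) f x := by
  have hd : ∀ n, Differentiable ℝ (iteratedDeriv n f) := fun n =>
    hf.differentiable_iteratedDeriv n (by exact_mod_cast ENat.natCast_lt_top n)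
  induction k generalizing x with
  | zero => simp
  | succ k ih =>
    have hfun : iteratedDeriv k (fun y : ℝ => (y : ℂ) * f y)
        = fun x : ℝ => (x : ℂ) * iteratedDeriv k f x + k * iteratedDeriv (k - 1) f x :=
      funext ih
    rw [iteratedDeriv_succ, hfun]
    have h1 : HasDerivAt (fun y : ℝ => (y : ℂ)) 1 x := Complex.ofRealCLM.hasDerivAt
    have h2 : HasDerivAt (iteratedDeriv k f) (iteratedDeriv (k + 1) f x) x := by
      rw [iteratedDeriv_succ]; exact (hd k x).hasDerivAt
    have h3 : HasDerivAt (fun y : ℝ => (k : ℂ) * iteratedDeriv (k - 1) f y)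
        ((k : ℂ) * iteratedDeriv k f x) x := by
      rcases k with _ | k
      · simpa using hasDerivAt_const x (0 : ℂ)
      · have := (hd k x).hasDerivAt
        rw [← iteratedDeriv_succ] at this
        exact this.const_mul _
    refine ((h1.mul h2).add h3).deriv.trans ?_
    simp only [Nat.add_sub_cancel]
    push_cast
    ring

lemma IsGelfandShilov.ofReal_mul {α β : ℝ≥0∞} {f : ℝ → ℂ} (hf : IsGelfandShilov α β f) :
    IsGelfandShilov α β (fun x : ℝ => (x : ℂ) * f x) := by
  obtain ⟨hf, a, b, ha, hb, h⟩ := hf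
  refine ⟨Complex.ofRealCLM.contDiff.mul hf, _, _, ha.shift.add ha, hb.add hb.pred,
    fun q k x => ?_⟩
  rw [iteratedDeriv_ofReal_mul hf, mul_add]
  have h1 := h (q + 1) k x
  have h2 := mul_le_mul_of_nonneg_left (h q (k - 1) x) (Nat.cast_nonneg (α := ℝ) k)
  have e1 : ‖(x : ℂ) ^ q * (x * iteratedDeriv k f x)‖ ≤ a (q + 1) * b k := by
    rwa [← mul_assoc, ← pow_succ]
  have e2 : ‖(x : ℂ) ^ q * (k * iteratedDeriv (k - 1) f x)‖ ≤ a q * (k * b (k - 1)) := by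
    rw [mul_left_comm, norm_mul, Complex.norm_natCast]
    linarith
  have p1 := mul_nonneg (ha.1 (q + 1)) (hb.pred.1 k)
  have p2 := mul_nonneg (ha.1 q) (hb.1 k)
  calc _ ≤ _ := norm_add_le _ _
    _ ≤ a (q + 1) * b k + a q * (k * b (k - 1)) := add_le_add e1 e2
    _ ≤ (a (q + 1) + a q) * (b k + k * b (k - 1)) := by
        simp only at p1
        nlinarith

/-- The Gelfand-Shilov space `S^β_α(ℝ)`, with lower index `α` and upper index `β`. -/
def gelfandShilov (α β : ℝ≥0∞) : Submodule ℂ (ℝ → ℂ) where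
  carrier := {f | IsGelfandShilov α β f}
  zero_mem' := IsGelfandShilov.zero α β
  add_mem' := IsGelfandShilov.add
  smul_mem' c _ hf := hf.const_smul c

/-! ## The Schrödinger representation in momentum space -/

/-- The momentum operator: multiplication by the variable. -/
def momentumOp (α β : ℝ≥0∞) : gelfandShilov α β →ₗ[ℂ] gelfandShilov α β where
  toFun f := ⟨fun x : ℝ => (x : ℂ) * f.1 x, IsGelfandShilov.ofReal_mul f.2⟩
  map_add' f g := by ext x; simp [mul_add]
  map_smul' c f := by ext x; simp [mul_left_comm]

/-- The position operator in momentum space: `f ↦ i f'`. -/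
noncomputable def positionOp (α β : ℝ≥0∞) : gelfandShilov α β →ₗ[ℂ] gelfandShilov α β where
  toFun f := ⟨Complex.I • deriv f.1, (IsGelfandShilov.deriv f.2).const_smul Complex.I⟩
  map_add' f g := by
    ext x
    have hf : DifferentiableAt ℝ f.1 x := (f.2.1.differentiable (by simp)) x
    have hg : DifferentiableAt ℝ g.1 x := (g.2.1.differentiable (by simp)) x
    simp [deriv_add hf hg, mul_add]
  map_smul' c f := by
    ext x
    have hf : DifferentiableAt ℝ f.1 x := (f.2.1.differentiable (by simp)) x
    simp [deriv_const_smul c hf, mul_left_comm]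

/-! ## The symbol and the indefinite inner product -/

/-- `J` is entire and infra-exponential of order `s`: for every `ε > 0` there is `C > 0` with
`|J(ξ)| ≤ C exp(ε |ξ| ^ s)` for all `ξ`. -/
def IsInfraExponential (J : ℂ → ℂ) (s : ℝ) : Prop :=
  Differentiable ℂ J ∧ ∀ ε > 0, ∃ C > 0, ∀ ξ : ℂ, ‖J ξ‖ ≤ C * Real.exp (ε * ‖ξ‖ ^ s)

/-- `⟨f, g⟩ = ∫ f̄ g - ∑ₖ cₖ² f̄⁽ᵏ⁾(0) g⁽ᵏ⁾(0)`. -/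
noncomputable def indefProd (c : ℕ → ℝ) (f g : ℝ → ℂ) : ℂ :=
  (∫ x, conj (f x) * g x) -
    ∑' k, ((c k ^ 2 : ℝ) : ℂ) * conj (iteratedDeriv k f 0) * iteratedDeriv k g 0

/-- The integral and the series in the definition of `indefProd c f g` converge. -/
def IndefProdConverges (c : ℕ → ℝ) (f g : ℝ → ℂ) : Prop :=
  Integrable (fun x => conj (f x) * g x) ∧
    Summable (fun k => ((c k ^ 2 : ℝ) : ℂ) * conj (iteratedDeriv k f 0) * iteratedDeriv k g 0)

/-! ## Indefinite inner product spaces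

Inner products are antilinear in the first and linear in the second argument. -/

section Indefinite

variable {K : Type*} [AddCommGroup K] [Module ℂ K]

/-- The form is hermitian. -/
def IsHermitianForm (B : K →ₗ⋆[ℂ] K →ₗ[ℂ] ℂ) : Prop :=
  ∀ x y, B y x = conj (B x y)

/-- The subspace `W` is positive definite. -/
def IsPosDefOn (B : K →ₗ⋆[ℂ] K →ₗ[ℂ] ℂ) (W : Submodule ℂ K) : Prop :=
  ∀ x ∈ W, x ≠ 0 → 0 < (B x x).re

/-- The subspace `W` is negative definite. -/
def IsNegDefOn (B : K →ₗ⋆[ℂ] K →ₗ[ℂ] ℂ) (W : Submodule ℂ K) : Prop :=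
  ∀ x ∈ W, x ≠ 0 → (B x x).re < 0

/-- A fundamental decomposition `K = K⁺ ∔ K⁻` (of a non-degenerate space): a direct sum of
mutually orthogonal subspaces, the first positive and the second negative definite. -/
def IsFundamentalDecomposition (B : K →ₗ⋆[ℂ] K →ₗ[ℂ] ℂ) (Kp Km : Submodule ℂ K) : Prop :=
  IsCompl Kp Km ∧ (∀ x ∈ Kp, ∀ y ∈ Km, B x y = 0) ∧ IsPosDefOn B Kp ∧ IsNegDefOn B Km

/-- Intrinsic completeness of a definite subspace `W`: completeness for the norm
`x ↦ |⟨x, x⟩| ^ (1/2)`. -/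
def IsIntrinsicallyComplete (B : K →ₗ⋆[ℂ] K →ₗ[ℂ] ℂ) (W : Submodule ℂ K) : Prop :=
  ∀ u : ℕ → K, (∀ n, u n ∈ W) →
    (∀ ε > 0, ∃ N, ∀ m ≥ N, ∀ n ≥ N, ‖B (u m - u n) (u m - u n)‖ < ε) →
    ∃ x ∈ W, Tendsto (fun n => ‖B (u n - x) (u n - x)‖) atTop (𝓝 0)

/-- Krein spaces: non-degenerate hermitian inner product spaces with a fundamental decomposition
into intrinsically complete subspaces. -/
def IsKreinSpace (B : K →ₗ⋆[ℂ] K →ₗ[ℂ] ℂ) : Prop :=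
  IsHermitianForm B ∧ (∀ x, (∀ y, B x y = 0) → x = 0) ∧
    ∃ Kp Km : Submodule ℂ K, IsFundamentalDecomposition B Kp Km ∧
      IsIntrinsicallyComplete B Kp ∧ IsIntrinsicallyComplete B Km

/-- The rank of negativity is `ℵ₀`: in every fundamental decomposition, the negative definite
part, with the inner product `-⟨·,·⟩`, has a countably infinite complete orthonormal system. -/
def HasCountablyInfiniteNegativityRank (B : K →ₗ⋆[ℂ] K →ₗ[ℂ] ℂ) : Prop :=
  ∀ Kp Km : Submodule ℂ K, IsFundamentalDecomposition B Kp Km →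
    ∃ e : ℕ → K, (∀ n, e n ∈ Km) ∧ (∀ m n, B (e m) (e n) = if m = n then -1 else 0) ∧
      ∀ x ∈ Km, ∀ ε > 0, ∃ y ∈ Submodule.span ℂ (Set.range e), ‖B (x - y) (x - y)‖ < ε

/-- Majorant topologies of an inner product `Q`: locally convex vector space topologies for which
`Q` is jointly continuous. -/
def IsMajorantTopology (Q : K → K → ℂ) (t : TopologicalSpace K) : Prop :=
  @IsTopologicalAddGroup K t _ ∧ @ContinuousSMul ℂ K _ _ t ∧ @LocallyConvexSpace ℝ K _ _ _ _ t ∧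
    @Continuous (K × K) ℂ (@instTopologicalSpaceProd K K t t) _ (fun x => Q x.1 x.2)

/-- Minimal majorants: no majorant is strictly weaker. (In the order on topologies, `t ≤ t'`
means that `t'` is weaker than `t`.) -/
def IsMinimalMajorant (Q : K → K → ℂ) (t : TopologicalSpace K) : Prop :=
  IsMajorantTopology Q t ∧ ∀ t', IsMajorantTopology Q t' → t ≤ t' → t' = t

end Indefinite

/-- `ι : E → K` exhibits the Hilbert space `K`, with the continuous indefinite inner product `B`,
as a maximal Krein space completion of the indefinite inner product space `(E, Q)`:
`K` is a Krein space, `ι` is an isometric embedding with dense range, and the quadratic normed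
topology that `E` inherits from the Hilbert topology of `K` is a minimal majorant. -/
structure IsMaximalKreinCompletion {E K : Type*} [AddCommGroup E] [Module ℂ E]
    [NormedAddCommGroup K] [InnerProductSpace ℂ K] [CompleteSpace K]
    (Q : E → E → ℂ) (B : K →ₗ⋆[ℂ] K →ₗ[ℂ] ℂ) (ι : E →ₗ[ℂ] K) : Prop where
  injective : Function.Injective ι
  denseRange : DenseRange ι
  isometric : ∀ f g, B (ι f) (ι g) = Q f g
  continuous : Continuous fun x : K × K => B x.1 x.2
  krein : IsKreinSpace B
  minimal : IsMinimalMajorant Q (TopologicalSpace.induced ι inferInstance)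

/-! ## Invariant subspaces and selfadjoint operators -/

section Representation

variable {K : Type*} [NormedAddCommGroup K] [NormedSpace ℂ K]

/-- `A` is a densely defined selfadjoint operator in the subspace `W`, with respect to the inner
product `B` on `W`: its graph coincides with that of its adjoint. -/
def IsSelfAdjointOperatorOn (B : K →ₗ⋆[ℂ] K →ₗ[ℂ] ℂ) (W : Submodule ℂ K) (A : K →ₗ.[ℂ] K) :
    Prop :=
  A.domain ≤ W ∧ (W : Set K) ⊆ closure A.domain ∧ (∀ x, A x ∈ W) ∧
    ∀ y ∈ W, ∀ z ∈ W, (y, z) ∈ A.graph ↔ ∀ x : A.domain, B (A x) y = B x z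

/-- The subspace `W` of `K` is invariant under the Schrödinger representation, which acts on it by
symmetric operators: the elements of `W` in the test function space `S^β_α` are dense in `W`; the
momentum and the position operator map them to elements of `W`, and are symmetric on them. -/
structure IsSchrodingerInvariant {α β : ℝ≥0∞} (B : K →ₗ⋆[ℂ] K →ₗ[ℂ] ℂ)
    (ι : gelfandShilov α β →ₗ[ℂ] K) (W : Submodule ℂ K) : Prop where
  dense : (W : Set K) ⊆ closure {x | x ∈ W ∧ ∃ f, ι f = x}
  momentum_mem : ∀ f, ι f ∈ W → ι (momentumOp α β f) ∈ W
  position_mem : ∀ f, ι f ∈ W → ι (positionOp α β f) ∈ W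
  momentum_symm : ∀ f g, ι f ∈ W → ι g ∈ W →
    B (ι (momentumOp α β f)) (ι g) = B (ι f) (ι (momentumOp α β g))
  position_symm : ∀ f g, ι f ∈ W → ι g ∈ W →
    B (ι (positionOp α β f)) (ι g) = B (ι f) (ι (positionOp α β g))

end Representation

/-! ## Square-integrable functions with vanishing moments -/

/-- `L²_0(ℝ)`: the `L²` functions all of whose moments exist and vanish. -/
def lTwoZero : Set (Lp ℂ 2 (volume : Measure ℝ)) :=
  {f | ∀ k : ℕ, Integrable (fun x : ℝ => (x : ℂ) ^ k * f x) ∧ ∫ x : ℝ, (x : ℂ) ^ k * f x = 0}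

/-- The Fourier transform of `L²_0(ℝ)`. As `L²_0(ℝ)` is invariant under dilations and scalar
multiples, this set does not depend on the normalization of the Fourier transform. -/
noncomputable def fourierLTwoZero : Set (Lp ℂ 2 (volume : Measure ℝ)) :=
  (fun f => 𝓕 f) '' lTwoZero

-- Take `K = L² ⊕ ℓ²` with the difference of the two inner products, and embed `V` by `f ↦ (f, (c_k
-- f⁽ᵏ⁾(0))_k)`. Cauchy's estimates make `c_k²` at most of order `e^k k^(-2δk)`, while `f⁽ᵏ⁾(0)`
-- grows at most like `B^k k^(βk)`; as `β < δ`, the second component is square summable and the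
-- embedding is isometric for the indefinite product. The space `H` is `L² ⊕ 0`. Its test functions
-- are exactly the flat ones, with zero Taylor series at `0`, because all `c_k` are nonzero; on the
-- Fourier side this says that all moments vanish.
--
-- Density uses `1 < β`: there are compactly supported Gevrey functions, built from `exp
-- (-x^(-1/(β-1)))`, and those supported away from `0` are flat and already dense in `L²`
-- (`dense_image_flatGelfandShilov`). A vector of `K` orthogonal to `V` therefore has no `L²`
-- component, and a dilation argument (`eq_zero_of_orthogonal_jetMap`) removes its `ℓ²` component.
-- The majorant is minimal because the form, tested against the image of a vector under the
-- fundamental symmetry, recovers the Hilbert norm (`isMinimalMajorant_induced`).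
--
-- The main point is that `H` contains every invariant `W`
-- (`le_kreinPos_of_isSchrodingerInvariant`). Let `g ∈ V ∩ W`, and let `v_n` be the `ℓ²` component
-- of `x^n g`. Momentum is symmetric on `W` and on `L²`, hence also on the `ℓ²` components:
-- `⟨v_{n+1}, v_m⟩ = ⟨v_n, v_{m+1}⟩`. So `‖v_{n+1}‖² ≤ ‖v_n‖ ‖v_{n+2}‖`, and a log-convex sequence
-- with `‖v_1‖ ≠ 0` is bounded below by a geometric one. But `v_n` lives in degrees `≥ n`, where the
-- `c_k` make it decay faster than every geometric sequence. Thus `v_1 = 0`, which forces `g(0) =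
-- 0`; applying this to the iterates of the position operator on `g` shows that `g` is flat.
--
-- On `H`, momentum is multiplication by `x`, and position is multiplication by `-2πx` after a
-- Fourier transform; real multiplication operators on their maximal domains are selfadjoint.

/-! ## Gevrey functions -/

/-- The germ at `0+` of a flat Gevrey function, as a holomorphic function on the right half plane. -/
noncomputable def flatExp (a : ℝ) (z : ℂ) : ℂ := Complex.exp (-(z ^ (-(a : ℂ))))

/-- By homogeneity it suffices to look near `1`: writing `z = x w` gives `z^(-a) = x^(-a) w^(-a)`,
and one radius `ρ` around `w = 1` serves all `x > 0`. -/
lemma exists_re_cpow_neg_ge (a : ℝ) : ∃ ρ : ℝ, 0 < ρ ∧ ∀ x : ℝ, 0 < x →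
    ∀ z ∈ Metric.closedBall (x : ℂ) (ρ * x),
      z ∈ Complex.slitPlane ∧ x ^ (-a) / 2 ≤ (z ^ (-(a : ℂ))).re := by
  have hcont : ContinuousAt (fun w : ℂ => (w ^ (-(a : ℂ))).re) 1 :=
    Complex.continuous_re.continuousAt.comp
      (continuousAt_id.cpow continuousAt_const Complex.one_mem_slitPlane)
  have h1 : ∀ᶠ w in 𝓝 (1 : ℂ), (1 / 2 : ℝ) < (w ^ (-(a : ℂ))).re := by
    refine hcont.eventually (lt_mem_nhds ?_)
    simp only [Complex.one_cpow, Complex.one_re]; norm_num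
  have h2 : ∀ᶠ w in 𝓝 (1 : ℂ), w ∈ Complex.slitPlane :=
    Complex.isOpen_slitPlane.mem_nhds Complex.one_mem_slitPlane
  obtain ⟨ρ, hρ, h⟩ := Metric.nhds_basis_closedBall.eventually_iff.1 (h1.and h2)
  refine ⟨ρ, hρ, fun x hx z hz => ?_⟩
  have hx0 : (x : ℂ) ≠ 0 := by exact_mod_cast hx.ne'
  obtain ⟨w, rfl⟩ : ∃ w, z = x * w := ⟨z / x, by field_simp⟩
  have hw : w ∈ Metric.closedBall (1 : ℂ) ρ := by
    rw [mem_closedBall_iff_norm] at hz ⊢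
    have : (x : ℂ) * w - x = x * (w - 1) := by ring
    rw [this, norm_mul, Complex.norm_real, Real.norm_of_nonneg hx.le, mul_comm] at hz
    exact le_of_mul_le_mul_right hz hx
  obtain ⟨h3, h4⟩ := h hw
  have hw0 : w ≠ 0 := Complex.slitPlane_ne_zero h4
  have hlog : Complex.log (x * w) = Real.log x + Complex.log w := Complex.log_ofReal_mul hx hw0
  constructor
  · rw [Complex.mem_slitPlane_iff] at h4 ⊢
    simp only [Complex.mul_re, Complex.ofReal_re, Complex.ofReal_im, zero_mul, sub_zero,
      Complex.mul_im, add_zero]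
    rcases h4 with h4 | h4
    · left; positivity
    · right; exact mul_ne_zero hx.ne' h4
  · have : ((x : ℂ) * w) ^ (-(a : ℂ)) = ((x ^ (-a) : ℝ) : ℂ) * w ^ (-(a : ℂ)) := by
      rw [Complex.cpow_def_of_ne_zero (mul_ne_zero hx0 hw0), hlog, add_mul, Complex.exp_add,
        Complex.cpow_def_of_ne_zero hw0, Real.rpow_def_of_pos hx]
      push_cast
      rfl
    rw [this, Complex.re_ofReal_mul]
    have := Real.rpow_pos_of_pos hx (-a)
    nlinarith

lemma differentiableAt_flatExp (a : ℝ) {z : ℂ} (hz : z ∈ Complex.slitPlane) :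
    DifferentiableAt ℂ (flatExp a) z :=
  ((differentiableAt_id.cpow_const hz).neg).cexp

/-- Cauchy's estimate on the disc of radius `ρ x`. The radius shrinks linearly with `x`, and the
exponential factor compensates for this. -/
lemma exists_norm_iteratedDeriv_flatExp_le (a : ℝ) : ∃ ρ : ℝ, 0 < ρ ∧ ∀ x : ℝ, 0 < x → ∀ k : ℕ,
    ‖iteratedDeriv k (flatExp a) x‖ ≤ k ! * Real.exp (-(x ^ (-a) / 2)) / (ρ * x) ^ k := by
  obtain ⟨ρ, hρ, h⟩ := exists_re_cpow_neg_ge a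
  refine ⟨ρ, hρ, fun x hx k => ?_⟩
  refine Complex.norm_iteratedDeriv_le_of_forall_mem_sphere_norm_le k (by positivity)
    (DifferentiableOn.diffContOnCl fun z hz => ?_) fun z hz => ?_
  · exact (differentiableAt_flatExp a
      (h x hx z (Metric.closure_ball_subset_closedBall hz)).1).differentiableWithinAt
  · rw [flatExp, Complex.norm_exp, Complex.neg_re]
    exact Real.exp_le_exp.2 (neg_le_neg (h x hx z (Metric.sphere_subset_closedBall hz)).2)

/-- Raise `y / (2 s) ≤ exp (y / (2 s))` to the power `s`. With `y = x^(-a)` this bounds negative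
powers of `x` against the exponential. -/
lemma rpow_mul_exp_neg_le {y s : ℝ} (hy : 0 ≤ y) (hs : 0 ≤ s) :
    y ^ s * Real.exp (-(y / 2)) ≤ (2 * s) ^ s := by
  rcases hs.eq_or_lt with rfl | hs'
  · simp only [Real.rpow_zero, one_mul, Real.exp_le_one_iff]; linarith
  have h1 : y / (2 * s) ≤ Real.exp (y / (2 * s)) := by
    linarith [Real.add_one_le_exp (y / (2 * s))]
  have h2 : (y / (2 * s)) ^ s ≤ Real.exp (y / 2) := by
    calc (y / (2 * s)) ^ s ≤ Real.exp (y / (2 * s)) ^ s :=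
          Real.rpow_le_rpow (by positivity) h1 hs
      _ = Real.exp (y / 2) := by rw [← Real.exp_mul]; congr 1; field_simp
  rw [Real.div_rpow hy (by positivity), div_le_iff₀ (by positivity)] at h2
  rw [Real.exp_neg, ← div_eq_mul_inv, div_le_iff₀ (Real.exp_pos _), mul_comm]
  exact h2

/-- The `k`-th derivative of the flat Gevrey function `x ↦ exp (-x ^ (-a))`, `x > 0`. -/
noncomputable def flatExpDeriv (a : ℝ) (k : ℕ) (x : ℝ) : ℂ :=
  if x ≤ 0 then 0 else iteratedDeriv k (flatExp a) x

/-- With `s = (k + m) / a`, the power `(x^(-a))^s` is `x^(-(k+m))`: `k` of these factors absorb the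
Cauchy denominator, and `m` remain to give vanishing at `0`. -/
lemma exists_norm_flatExpDeriv_le_mul_pow {a : ℝ} (ha : 0 < a) (k m : ℕ) :
    ∃ C, 0 ≤ C ∧ ∀ x, ‖flatExpDeriv a k x‖ ≤ C * |x| ^ m := by
  obtain ⟨ρ, hρ, h⟩ := exists_norm_iteratedDeriv_flatExp_le a
  refine ⟨k ! / ρ ^ k * (2 * ((k + m) / a)) ^ ((k + m) / a), by positivity, fun x => ?_⟩
  rw [flatExpDeriv]
  split_ifs with hx
  · rw [norm_zero]; positivity
  push Not at hx
  have h1 := rpow_mul_exp_neg_le (y := x ^ (-a)) (s := (k + m) / a) (by positivity) (by positivity)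
  have h2 : (x ^ (-a)) ^ ((k + m) / a) = (x ^ (k + m))⁻¹ := by
    rw [← Real.rpow_mul hx.le, ← Real.rpow_natCast, ← Real.rpow_neg hx.le]
    congr 1; push_cast; field_simp
  rw [h2] at h1
  refine (h x hx k).trans ?_
  rw [abs_of_pos hx]
  calc k ! * Real.exp (-(x ^ (-a) / 2)) / (ρ * x) ^ k
      = k ! / ρ ^ k * ((x ^ (k + m))⁻¹ * Real.exp (-(x ^ (-a) / 2))) * x ^ m := by
        rw [mul_pow, pow_add]; field_simp
    _ ≤ _ := by gcongr

lemma hasDerivAt_flatExpDeriv {a : ℝ} (ha : 0 < a) (k : ℕ) (x : ℝ) :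
    HasDerivAt (flatExpDeriv a k) (flatExpDeriv a (k + 1) x) x := by
  rcases lt_trichotomy x 0 with hx | rfl | hx
  · have h0 : flatExpDeriv a (k + 1) x = 0 := if_pos hx.le
    rw [h0]
    refine (hasDerivAt_const x (0 : ℂ)).congr_of_eventuallyEq ?_
    filter_upwards [gt_mem_nhds hx] with y hy using if_pos hy.le
  · have h0 : flatExpDeriv a (k + 1) 0 = 0 := if_pos le_rfl
    have h0' : flatExpDeriv a k 0 = 0 := if_pos le_rfl
    -- A quadratic bound makes the difference quotient at `0` tend to `0`.
    obtain ⟨C, hC, h⟩ := exists_norm_flatExpDeriv_le_mul_pow ha k 2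
    rw [h0, hasDerivAt_iff_isLittleO_nhds_zero]
    simp only [zero_add, h0', sub_zero, smul_zero]
    have h1 : flatExpDeriv a k =O[𝓝 0] fun x : ℝ => x ^ 2 :=
      Asymptotics.IsBigO.of_bound C (Eventually.of_forall fun x => by
        simpa [abs_pow] using h x)
    exact h1.trans_isLittleO (by simpa using Asymptotics.isLittleO_pow_id (𝕜 := ℝ) one_lt_two)
  · have h0 : flatExpDeriv a (k + 1) x = iteratedDeriv (k + 1) (flatExp a) x :=
      if_neg (not_le.2 hx)
    rw [h0]
    have hx' : (x : ℂ) ∈ Complex.slitPlane := Or.inl (by simpa using hx)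
    have han : AnalyticAt ℂ (flatExp a) x :=
      DifferentiableOn.analyticAt (s := Complex.slitPlane)
        (fun z hz => (differentiableAt_flatExp a hz).differentiableWithinAt)
        (Complex.isOpen_slitPlane.mem_nhds hx')
    have hd : HasDerivAt (iteratedDeriv k (flatExp a)) (iteratedDeriv (k + 1) (flatExp a) x) x := by
      rw [iteratedDeriv_succ]
      exact ((han.iterated_deriv k).congr
        (by rw [iteratedDeriv_eq_iterate])).differentiableAt.hasDerivAt
    refine hd.comp_ofReal.congr_of_eventuallyEq ?_
    filter_upwards [lt_mem_nhds hx] with y hy using if_neg (not_le.2 hy)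

lemma iteratedDeriv_flatExpDeriv_zero {a : ℝ} (ha : 0 < a) (k : ℕ) :
    iteratedDeriv k (flatExpDeriv a 0) = flatExpDeriv a k := by
  induction k with
  | zero => simp
  | succ k ih =>
    rw [iteratedDeriv_succ, ih]
    exact funext fun x => (hasDerivAt_flatExpDeriv ha k x).deriv

/-- Smooth functions on the line all of whose derivatives are bounded, with bounds admissible for
the index `β`. -/
def IsGevrey (β : ℝ≥0∞) (f : ℝ → ℂ) : Prop :=
  ContDiff ℝ ∞ f ∧ ∃ b : ℕ → ℝ, IsGelfandShilovWeight β b ∧ ∀ k x, ‖iteratedDeriv k f x‖ ≤ b k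

/-- With `t = β - 1 = 1/a` and `s = k t`, the singular factor `x^(-k)` costs at most `(2kt)^(kt)`.
Together with `k! ≤ k^k` this gives `k^(k + kt) = k^(kβ)`, so the exponent `a` is matched to `β`. -/
lemma isGevrey_flatExpDeriv_zero {β : ℝ≥0} (hβ : 1 < β) :
    IsGevrey β (flatExpDeriv (1 / ((β : ℝ) - 1)) 0) := by
  have hβ' : (0 : ℝ) < (β : ℝ) - 1 := by
    have : (1 : ℝ) < β := by exact_mod_cast hβ
    linarith
  set a : ℝ := 1 / ((β : ℝ) - 1) with ha_def
  have ha : 0 < a := by positivity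
  refine ⟨contDiff_of_differentiable_iteratedDeriv fun m _ => ?_, ?_⟩
  · rw [iteratedDeriv_flatExpDeriv_zero ha]
    exact fun x => (hasDerivAt_flatExpDeriv ha m x).differentiableAt
  obtain ⟨ρ, hρ, h⟩ := exists_norm_iteratedDeriv_flatExp_le a
  set t : ℝ := (β : ℝ) - 1
  refine ⟨fun k => (ρ⁻¹ * (2 * t) ^ t) ^ k * (k : ℝ) ^ ((k : ℝ) * β),
    ⟨fun k => by positivity, fun _ => ⟨1, one_pos, ρ⁻¹ * (2 * t) ^ t, by positivity, fun k => by
      simp⟩⟩, fun k x => ?_⟩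
  rw [iteratedDeriv_flatExpDeriv_zero ha, flatExpDeriv]
  split_ifs with hx
  · rw [norm_zero]; positivity
  push Not at hx
  have h1 := rpow_mul_exp_neg_le (y := x ^ (-a)) (s := k * t) (by positivity) (by positivity)
  have h2 : (x ^ (-a)) ^ (k * t) = (x ^ k)⁻¹ := by
    rw [← Real.rpow_mul hx.le, ← Real.rpow_natCast, ← Real.rpow_neg hx.le]
    congr 1; rw [ha_def]; field_simp
  rw [h2] at h1
  have h3 : (2 * (k * t)) ^ (k * t) = ((2 * t) ^ t) ^ k * (k : ℝ) ^ (k * t) := by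
    rw [show 2 * (k * t) = (2 * t) * k by ring, Real.mul_rpow (by positivity) (by positivity),
      mul_comm (k : ℝ) t, Real.rpow_mul (by positivity), Real.rpow_natCast]
  have h4 : (k : ℝ) ^ ((k : ℝ) * β) = (k : ℝ) ^ k * (k : ℝ) ^ (k * t) := by
    rcases Nat.eq_zero_or_pos k with rfl | hk
    · simp
    rw [← Real.rpow_natCast, ← Real.rpow_add (by positivity)]
    congr 1; simp only [t]; ring
  have h5 : (k ! : ℝ) ≤ (k : ℝ) ^ k := by exact_mod_cast Nat.factorial_le_pow k
  refine (h x hx k).trans ?_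
  calc k ! * Real.exp (-(x ^ (-a) / 2)) / (ρ * x) ^ k
      = k ! * ρ⁻¹ ^ k * ((x ^ k)⁻¹ * Real.exp (-(x ^ (-a) / 2))) := by
        rw [mul_pow, inv_pow]; field_simp
    _ ≤ (k : ℝ) ^ k * ρ⁻¹ ^ k * (((2 * t) ^ t) ^ k * (k : ℝ) ^ (k * t)) := by
        rw [← h3]; gcongr
    _ = _ := by simp only [h4, mul_pow]; ring

-- Stability properties of Gevrey functions

lemma IsGelfandShilovWeight.geom_mul {s : ℝ≥0∞} {a : ℕ → ℝ} (ha : IsGelfandShilovWeight s a)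
    {c : ℝ} (hc : 0 ≤ c) : IsGelfandShilovWeight s (fun n => c ^ n * a n) := by
  refine ⟨fun n => mul_nonneg (by positivity) (ha.1 n), fun hs => ?_⟩
  obtain ⟨C, hC, A, hA, h⟩ := ha.2 hs
  refine ⟨C, hC, (c + 1) * A, by positivity, fun n => ?_⟩
  calc c ^ n * a n ≤ (c + 1) ^ n * (C * A ^ n * (n : ℝ) ^ ((n : ℝ) * s.toReal)) :=
        mul_le_mul (by gcongr; linarith) (h n) (ha.1 n) (by positivity)
    _ = _ := by rw [mul_pow]; ring

lemma isGelfandShilovWeight_geom {s : ℝ≥0∞} {A : ℝ} (hA : 0 < A) :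
    IsGelfandShilovWeight s (fun n => A ^ n) := by
  refine ⟨fun n => by positivity, fun _ => ⟨1, one_pos, A, hA, fun n => ?_⟩⟩
  rw [one_mul]
  refine le_mul_of_one_le_right (by positivity) ?_
  rcases Nat.eq_zero_or_pos n with rfl | hn
  · simp
  · exact Real.one_le_rpow (by exact_mod_cast hn) (by positivity)

/-- Leibniz' rule: the weights satisfy `w i * w (n - i) ≤ w n`, since both bases are at most `n`,
and the binomial coefficients add up to the geometric factor `2 ^ n`. -/
lemma IsGevrey.mul {β : ℝ≥0∞} (hβ : β ≠ ⊤) {f g : ℝ → ℂ} (hf : IsGevrey β f) (hg : IsGevrey β g) :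
    IsGevrey β (f * g) := by
  obtain ⟨hf, a, ha, hfa⟩ := hf
  obtain ⟨hg, b, hb, hgb⟩ := hg
  obtain ⟨C, hC, A, hA, h⟩ := ha.exists_one_le hβ
  obtain ⟨C', hC', A', hA', h'⟩ := hb.exists_one_le hβ
  set w : ℕ → ℝ := fun n => (n : ℝ) ^ ((n : ℝ) * β.toReal)
  have hw : ∀ i n, i ≤ n → w i * w (n - i) ≤ w n := by
    intro i n hin
    rcases Nat.eq_zero_or_pos n with rfl | hn
    · obtain rfl : i = 0 := by omega
      simp [w]
    have hβ0 : 0 ≤ β.toReal := ENNReal.toReal_nonneg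
    calc w i * w (n - i) ≤ (n : ℝ) ^ ((i : ℝ) * β.toReal) *
          (n : ℝ) ^ (((n - i : ℕ) : ℝ) * β.toReal) := by
          simp only [w]
          gcongr
          omega
      _ = w n := by
          rw [← Real.rpow_add (by positivity), Nat.cast_sub hin]
          simp only [w]; congr 1; ring
  refine ⟨hf.mul hg, fun n => C * C' * (2 * (A * A')) ^ n * w n,
    ⟨fun n => by positivity, fun _ => ⟨C * C', by positivity, 2 * (A * A'), by positivity,
      fun n => le_rfl⟩⟩, fun n x => ?_⟩
  rw [iteratedDeriv_mul ((hf.of_le (by exact_mod_cast le_top)).contDiffAt)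
    ((hg.of_le (by exact_mod_cast le_top)).contDiffAt)]
  calc _ ≤ ∑ i ∈ Finset.range (n + 1), (n.choose i : ℝ) * (C * C' * (A * A') ^ n * w n) := by
        refine norm_sum_le_of_le _ fun i hi => ?_
        have hin : i ≤ n := by simpa [Nat.lt_succ_iff] using hi
        rw [norm_mul, norm_mul, Complex.norm_natCast, mul_assoc]
        refine mul_le_mul_of_nonneg_left ?_ (Nat.cast_nonneg _)
        calc ‖iteratedDeriv i f x‖ * ‖iteratedDeriv (n - i) g x‖
            ≤ (C * A ^ i * w i) * (C' * A' ^ (n - i) * w (n - i)) := by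
              gcongr
              · exact (hfa i x).trans (h i)
              · exact (hgb _ x).trans (h' _)
          _ = C * C' * (A ^ i * A' ^ (n - i)) * (w i * w (n - i)) := by ring
          _ ≤ C * C' * (A ^ n * A' ^ n) * w n := by
              gcongr
              · omega
              · exact hw i n hin
          _ = C * C' * (A * A') ^ n * w n := by rw [mul_pow]
    _ = _ := by
        rw [← Finset.sum_mul]
        have : ∑ i ∈ Finset.range (n + 1), (n.choose i : ℝ) = 2 ^ n := by
          exact_mod_cast Nat.sum_range_choose n
        rw [this, mul_pow]; ring

lemma IsGevrey.comp_affine {β : ℝ≥0∞} {f : ℝ → ℂ} (hf : IsGevrey β f) (l s : ℝ) :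
    IsGevrey β (fun x => f (l * x + s)) := by
  obtain ⟨hf, b, hb, h⟩ := hf
  refine ⟨hf.comp ((contDiff_const.mul contDiff_id).add contDiff_const), _,
    hb.geom_mul (abs_nonneg l), fun k x => ?_⟩
  have hfs : ContDiff ℝ k (fun y => f (y + s)) :=
    (hf.of_le (by exact_mod_cast le_top)).comp (contDiff_id.add contDiff_const)
  rw [iteratedDeriv_comp_const_smul hfs l, iteratedDeriv_comp_add_const, norm_smul, norm_pow,
    Real.norm_eq_abs]
  exact mul_le_mul_of_nonneg_left (h k _) (by positivity)

/-- On a bounded support the powers `|x|^q` grow only geometrically in `q`, which is admissible for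
every lower index `α`, including `0`. -/
lemma IsGevrey.isGelfandShilov {α β : ℝ≥0∞} {f : ℝ → ℂ} (hf : IsGevrey β f) {R : ℝ}
    (hR : ∀ x, f x ≠ 0 → |x| ≤ R) : IsGelfandShilov α β f := by
  obtain ⟨hf, b, hb, h⟩ := hf
  refine ⟨hf, fun q => (|R| + 1) ^ q, b, isGelfandShilovWeight_geom (by positivity), hb,
    fun q k x => ?_⟩
  rcases le_or_gt |x| (|R|) with hx | hx
  · rw [norm_mul, norm_pow, Complex.norm_real, Real.norm_eq_abs]
    refine mul_le_mul ?_ (h k x) (norm_nonneg _) (by positivity)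
    exact pow_le_pow_left₀ (abs_nonneg x) (by linarith) q
  · have : iteratedDeriv k f x = 0 := by
      have h0 : f =ᶠ[𝓝 x] fun _ => 0 := by
        filter_upwards [continuous_abs.continuousAt.eventually (lt_mem_nhds hx)] with y hy
        by_contra hne
        exact absurd ((hR y hne).trans (le_abs_self R)) (not_le.2 hy)
      rw [h0.iteratedDeriv_eq, iteratedDeriv_const]; simp
    rw [this, mul_zero, norm_zero]
    exact mul_nonneg (by positivity) (hb.1 k)

/-- A smooth approximation of the indicator function of the interval `(p, q)`. -/
noncomputable def gevreyBump (β : ℝ≥0) (p q n : ℝ) : ℝ → ℂ :=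
  (fun x => flatExpDeriv (1 / ((β : ℝ) - 1)) 0 (n * x + -(n * p))) *
    fun x => flatExpDeriv (1 / ((β : ℝ) - 1)) 0 (-n * x + n * q)

lemma isGevrey_gevreyBump {β : ℝ≥0} (hβ : 1 < β) (p q n : ℝ) : IsGevrey β (gevreyBump β p q n) :=
  ((isGevrey_flatExpDeriv_zero hβ).comp_affine _ _).mul ENNReal.coe_ne_top
    ((isGevrey_flatExpDeriv_zero hβ).comp_affine _ _)

lemma flatExpDeriv_zero_of_pos {a x : ℝ} (hx : 0 < x) :
    flatExpDeriv a 0 x = (Real.exp (-(x ^ (-a))) : ℂ) := by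
  rw [flatExpDeriv, if_neg (not_le.2 hx), iteratedDeriv_zero, flatExp]
  push_cast [Complex.ofReal_cpow hx.le]
  rfl

lemma norm_flatExpDeriv_zero_le (a x : ℝ) : ‖flatExpDeriv a 0 x‖ ≤ 1 := by
  rcases le_or_gt x 0 with hx | hx
  · simp [flatExpDeriv, hx]
  · rw [flatExpDeriv_zero_of_pos hx, Complex.norm_real,
      Real.norm_of_nonneg (Real.exp_pos _).le, Real.exp_le_one_iff]
    have := Real.rpow_pos_of_pos hx (-a)
    linarith

lemma gevreyBump_eq_zero {β : ℝ≥0} {p q n : ℝ} (hn : 0 ≤ n) {x : ℝ} (hx : x ∉ Set.Ioo p q) :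
    gevreyBump β p q n x = 0 := by
  rw [Set.mem_Ioo, not_and_or, not_lt, not_lt] at hx
  simp only [gevreyBump, Pi.mul_apply]
  rcases hx with hx | hx
  · rw [flatExpDeriv, if_pos (by nlinarith), zero_mul]
  · rw [mul_comm, flatExpDeriv, if_pos (by nlinarith), zero_mul]

lemma gevreyBump_ne_zero {β : ℝ≥0} {p q n : ℝ} (hn : 0 < n) {x : ℝ} (hx : x ∈ Set.Ioo p q) :
    gevreyBump β p q n x ≠ 0 := by
  obtain ⟨h1, h2⟩ := hx
  simp only [gevreyBump, Pi.mul_apply]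
  rw [flatExpDeriv_zero_of_pos (by nlinarith), flatExpDeriv_zero_of_pos (by nlinarith)]
  exact mul_ne_zero (Complex.ofReal_ne_zero.2 (Real.exp_ne_zero _))
    (Complex.ofReal_ne_zero.2 (Real.exp_ne_zero _))

lemma norm_gevreyBump_le {β : ℝ≥0} {p q n x : ℝ} : ‖gevreyBump β p q n x‖ ≤ 1 := by
  simp only [gevreyBump, Pi.mul_apply, norm_mul]
  exact mul_le_one₀ (norm_flatExpDeriv_zero_le _ _) (norm_nonneg _) (norm_flatExpDeriv_zero_le _ _)

lemma tendsto_flatExpDeriv_zero {a y : ℝ} (ha : 0 < a) (hy : 0 < y) :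
    Tendsto (fun n : ℕ => flatExpDeriv a 0 (n * y)) atTop (𝓝 1) := by
  have h1 : Tendsto (fun n : ℕ => ((n : ℝ) * y)) atTop atTop :=
    tendsto_natCast_atTop_atTop.atTop_mul_const hy
  have h2 : Tendsto (fun n : ℕ => (Real.exp (-(((n : ℝ) * y) ^ (-a))))) atTop (𝓝 1) := by
    have := ((tendsto_rpow_neg_atTop ha).comp h1).neg.rexp
    simpa using this
  have h3 := (Complex.continuous_ofReal.tendsto 1).comp h2
  rw [Complex.ofReal_one] at h3
  refine h3.congr' ?_
  filter_upwards [eventually_gt_atTop 0] with n hn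
  have : (0 : ℝ) < n := by exact_mod_cast hn
  rw [flatExpDeriv_zero_of_pos (by positivity)]
  simp

lemma tendsto_gevreyBump {β : ℝ≥0} (hβ : 1 < β) (p q x : ℝ) :
    Tendsto (fun n : ℕ => gevreyBump β p q n x) atTop (𝓝 ((Set.Ioo p q).indicator 1 x)) := by
  have hβ' : (0 : ℝ) < (β : ℝ) - 1 := by
    have : (1 : ℝ) < β := by exact_mod_cast hβ
    linarith
  by_cases hx : x ∈ Set.Ioo p q
  · rw [Set.indicator_of_mem hx, Pi.one_apply]
    have h1 := tendsto_flatExpDeriv_zero (a := 1 / ((β : ℝ) - 1)) (by positivity) (sub_pos.2 hx.1)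
    have h2 := tendsto_flatExpDeriv_zero (a := 1 / ((β : ℝ) - 1)) (by positivity) (sub_pos.2 hx.2)
    have h3 := h1.mul h2
    rw [one_mul] at h3
    refine h3.congr fun n => ?_
    simp only [gevreyBump, Pi.mul_apply]
    congr 2 <;> ring
  · rw [Set.indicator_of_notMem hx]
    refine tendsto_const_nhds.congr fun n => (gevreyBump_eq_zero n.cast_nonneg hx).symm

/-! ## Gelfand-Shilov functions in the Schwartz space and in `L²` -/

/-- Gelfand-Shilov functions are Schwartz functions. -/
def gelfandShilovToSchwartz (α β : ℝ≥0∞) : gelfandShilov α β →ₗ[ℂ] SchwartzMap ℝ ℂ where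
  toFun f :=
    { toFun := f.1
      smooth' := f.2.1
      decay' := fun q k => by
        obtain ⟨a, b, -, -, h⟩ := f.2.2
        refine ⟨a q * b k, fun x => ?_⟩
        rw [norm_iteratedFDeriv_eq_norm_iteratedDeriv]
        simpa [norm_mul, norm_pow] using h q k x }
  map_add' f g := rfl
  map_smul' c f := rfl

/-- The class in `L²` of a Gelfand-Shilov function. -/
noncomputable def gelfandShilovToL2 (α β : ℝ≥0∞) :
    gelfandShilov α β →ₗ[ℂ] Lp ℂ 2 (volume : Measure ℝ) :=
  (SchwartzMap.toLpCLM ℂ ℂ 2 volume).toLinearMap ∘ₗ gelfandShilovToSchwartz α β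

lemma coeFn_gelfandShilovToL2 {α β : ℝ≥0∞} (f : gelfandShilov α β) :
    gelfandShilovToL2 α β f =ᵐ[volume] f.1 :=
  SchwartzMap.coeFn_toLp (gelfandShilovToSchwartz α β f) 2 volume

lemma integrable_conj_mul_gelfandShilov {α β : ℝ≥0∞} (f g : gelfandShilov α β) :
    Integrable (fun x => conj (f.1 x) * g.1 x) := by
  refine (L2.integrable_inner (𝕜 := ℂ) (gelfandShilovToL2 α β f)
    (gelfandShilovToL2 α β g)).congr ?_
  filter_upwards [coeFn_gelfandShilovToL2 f, coeFn_gelfandShilovToL2 g] with x hf hg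
  rw [hf, hg, RCLike.inner_apply, mul_comm]

lemma inner_gelfandShilovToL2 {α β : ℝ≥0∞} (f g : gelfandShilov α β) :
    inner ℂ (gelfandShilovToL2 α β f) (gelfandShilovToL2 α β g)
      = ∫ x, conj (f.1 x) * g.1 x := by
  rw [L2.inner_def]
  refine integral_congr_ae ?_
  filter_upwards [coeFn_gelfandShilovToL2 f, coeFn_gelfandShilovToL2 g] with x hf hg
  rw [hf, hg, RCLike.inner_apply, mul_comm]

/-- The Gelfand-Shilov functions with vanishing Taylor series at `0`. -/
def flatGelfandShilov (α β : ℝ≥0∞) : Submodule ℂ (gelfandShilov α β) where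
  carrier := {f | ∀ k, iteratedDeriv k f.1 0 = 0}
  zero_mem' k := by
    change iteratedDeriv k (fun _ : ℝ => (0 : ℂ)) 0 = 0
    simp
  add_mem' {f g} hf hg k := by
    change iteratedDeriv k (f.1 + g.1) 0 = 0
    rw [iteratedDeriv_add ((f.2.1.of_le (by exact_mod_cast le_top)).contDiffAt)
      ((g.2.1.of_le (by exact_mod_cast le_top)).contDiffAt), hf k, hg k, add_zero]
  smul_mem' c f hf k := by
    change iteratedDeriv k (c • f.1) 0 = 0
    rw [iteratedDeriv_const_smul ((f.2.1.of_le (by exact_mod_cast le_top)).contDiffAt), hf k,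
      smul_zero]

lemma mem_flatGelfandShilov {α β : ℝ≥0∞} {f : gelfandShilov α β} :
    f ∈ flatGelfandShilov α β ↔ ∀ k, iteratedDeriv k f.1 0 = 0 := Iff.rfl

/-- `gevreyBump` as an element of the Gelfand-Shilov space. -/
noncomputable def gelfandShilovBump (α : ℝ≥0∞) {β : ℝ≥0} (hβ : 1 < β) (p q : ℝ) (n : ℕ) :
    gelfandShilov α β :=
  ⟨gevreyBump β p q n, (isGevrey_gevreyBump hβ p q n).isGelfandShilov (R := max |p| |q|)
    fun x hx => by
      have h : x ∈ Set.Ioo p q := by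
        by_contra h
        exact hx (gevreyBump_eq_zero n.cast_nonneg h)
      exact abs_le_max_abs_abs h.1.le h.2.le⟩

lemma gelfandShilovBump_mem_flat (α : ℝ≥0∞) {β : ℝ≥0} (hβ : 1 < β) {p q : ℝ} (n : ℕ)
    (h : (0 : ℝ) ∉ Set.Icc p q) : gelfandShilovBump α hβ p q n ∈ flatGelfandShilov α β := by
  intro k
  have h0 : gevreyBump β p q n =ᶠ[𝓝 0] fun _ => 0 := by
    filter_upwards [isClosed_Icc.isOpen_compl.mem_nhds h] with y hy
    exact gevreyBump_eq_zero n.cast_nonneg fun hy' => hy (Set.Ioo_subset_Icc_self hy')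
  change iteratedDeriv k (gevreyBump β p q n) 0 = 0
  rw [h0.iteratedDeriv_eq, iteratedDeriv_const]; simp

/-- An interval away from `0` carries flat bumps, bounded by `1` and converging pointwise to its
indicator; dominated convergence passes the orthogonality to the limit. -/
lemma setIntegral_eq_zero_of_orthogonal_flat (α : ℝ≥0∞) {β : ℝ≥0} (hβ : 1 < β)
    {u : Lp ℂ 2 (volume : Measure ℝ)}
    (hu : ∀ f ∈ flatGelfandShilov α β, inner ℂ (gelfandShilovToL2 α β f) u = 0) {p q : ℝ}
    (h : (0 : ℝ) ∉ Set.Icc p q) : ∫ x in Set.Icc p q, u x = 0 := by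
  have hui : IntegrableOn u (Set.Ioo p q) :=
    ((Lp.memLp u).locallyIntegrable (by norm_num)).integrableOn_isCompact
      (isCompact_Icc (a := p) (b := q)) |>.mono_set Set.Ioo_subset_Icc_self
  have key : ∀ n : ℕ, ∫ x, conj (gevreyBump β p q n x) * u x = 0 := by
    intro n
    rw [← hu _ (gelfandShilovBump_mem_flat α hβ n h), L2.inner_def]
    refine integral_congr_ae ?_
    filter_upwards [coeFn_gelfandShilovToL2 (gelfandShilovBump α hβ p q n)] with x hx
    rw [hx, RCLike.inner_apply, mul_comm]
    rfl
  have hlim : Tendsto (fun n : ℕ => ∫ x, conj (gevreyBump β p q n x) * u x) atTop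
      (𝓝 (∫ x, (Set.Ioo p q).indicator u x)) := by
    refine tendsto_integral_of_dominated_convergence ((Set.Ioo p q).indicator fun x => ‖u x‖)
      (fun n => ?_) ?_ (fun n => ?_) ?_
    · exact (Complex.continuous_conj.comp
        (isGevrey_gevreyBump hβ p q n).1.continuous).aestronglyMeasurable.mul
        (Lp.aestronglyMeasurable u)
    · exact (integrable_indicator_iff measurableSet_Ioo).2 hui.norm
    · refine Eventually.of_forall fun x => ?_
      by_cases hx : x ∈ Set.Ioo p q
      · rw [Set.indicator_of_mem hx, norm_mul, RCLike.norm_conj]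
        exact mul_le_of_le_one_left (norm_nonneg _) norm_gevreyBump_le
      · rw [gevreyBump_eq_zero n.cast_nonneg hx, Set.indicator_of_notMem hx]
        simp
    · refine Eventually.of_forall fun x => ?_
      have := ((Complex.continuous_conj.tendsto _).comp (tendsto_gevreyBump hβ p q x)).mul_const
        (u x)
      refine this.trans (le_of_eq ?_)
      by_cases hx : x ∈ Set.Ioo p q <;> simp [hx]
  simp only [key] at hlim
  rw [integral_Icc_eq_integral_Ioo, ← integral_indicator measurableSet_Ioo]
  exact (tendsto_nhds_unique hlim tendsto_const_nhds)

/-- Lebesgue differentiation: small intervals around a point `x ≠ 0` avoid `0`, so the averages of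
`u` over them vanish. -/
lemma eq_zero_of_orthogonal_flat (α : ℝ≥0∞) {β : ℝ≥0} (hβ : 1 < β)
    {u : Lp ℂ 2 (volume : Measure ℝ)}
    (hu : ∀ f ∈ flatGelfandShilov α β, inner ℂ (gelfandShilovToL2 α β f) u = 0) : u = 0 := by
  have hloc : LocallyIntegrable u := (Lp.memLp u).locallyIntegrable (by norm_num)
  rw [Lp.eq_zero_iff_ae_eq_zero]
  have h0 : ∀ᵐ x : ℝ, x ≠ 0 := by simp [ae_iff]
  filter_upwards [IsUnifLocDoublingMeasure.ae_tendsto_average (μ := volume) hloc 1, h0]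
    with x hx hx0
  have hδ : Tendsto (fun n : ℕ => (1 / ((n : ℝ) + 1))) atTop (𝓝[>] 0) :=
    tendsto_nhdsWithin_iff.2 ⟨tendsto_one_div_add_atTop_nhds_zero_nat,
      Eventually.of_forall fun n => by simp only [Set.mem_Ioi]; positivity⟩
  have h1 := hx (fun _ => x) _ hδ (Eventually.of_forall fun n => by
    simp only [one_mul]; exact Metric.mem_closedBall_self (by positivity))
  refine tendsto_nhds_unique (h1.congr' ?_) tendsto_const_nhds
  have h2 : ∀ᶠ n : ℕ in atTop, 1 / ((n : ℝ) + 1) < |x| :=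
    tendsto_one_div_add_atTop_nhds_zero_nat.eventually (gt_mem_nhds (abs_pos.2 hx0))
  filter_upwards [h2] with n hn
  rw [setAverage_eq, Real.closedBall_eq_Icc, setIntegral_eq_zero_of_orthogonal_flat α hβ hu,
    smul_zero]
  · rfl
  · rw [← Real.closedBall_eq_Icc, Metric.mem_closedBall, Real.dist_eq, zero_sub, abs_neg, not_le]
    exact hn

/-- Functions with vanishing Taylor series at `0` are dense in `L²`. -/
lemma dense_image_flatGelfandShilov (α : ℝ≥0∞) {β : ℝ≥0} (hβ : 1 < β) :
    Dense (gelfandShilovToL2 α β '' (flatGelfandShilov α β : Set (gelfandShilov α β))) := by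
  rw [← Submodule.map_coe, Submodule.dense_iff_topologicalClosure_eq_top,
    Submodule.topologicalClosure_eq_top_iff, Submodule.eq_bot_iff]
  intro u hu
  refine eq_zero_of_orthogonal_flat α hβ fun f hf => ?_
  exact (Submodule.mem_orthogonal _ _).1 hu _ ⟨f, hf, rfl⟩

/-! ## The standard Krein space -/

lemma withLp_prod_ext {E F : Type*} {x y : WithLp 2 (E × F)} (h1 : x.fst = y.fst) (h2 : x.snd = y.snd) :
    x = y := by
  obtain ⟨⟨a, b⟩⟩ := x
  obtain ⟨⟨a', b'⟩⟩ := y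
  simp only [WithLp.toLp_fst, WithLp.toLp_snd] at h1 h2
  rw [h1, h2]

section Krein

variable {E F : Type*} [NormedAddCommGroup E] [InnerProductSpace ℂ E]
  [NormedAddCommGroup F] [InnerProductSpace ℂ F]

variable (E F) in
/-- The indefinite inner product `⟨x₁, y₁⟩ - ⟨x₂, y₂⟩` on the Hilbert sum `E ⊕ F`. -/
noncomputable def kreinForm : WithLp 2 (E × F) →ₗ⋆[ℂ] WithLp 2 (E × F) →ₗ[ℂ] ℂ :=
  LinearMap.mk₂'ₛₗ (starRingEnd ℂ) (RingHom.id ℂ)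
    (fun x y => inner ℂ x.fst y.fst - inner ℂ x.snd y.snd)
    (fun x x' y => by simp only [WithLp.add_fst, WithLp.add_snd, inner_add_left]; ring)
    (fun c x y => by
      simp only [WithLp.smul_fst, WithLp.smul_snd, inner_smul_left, smul_eq_mul]; ring)
    (fun x y y' => by simp only [WithLp.add_fst, WithLp.add_snd, inner_add_right]; ring)
    (fun c x y => by
      simp only [WithLp.smul_fst, WithLp.smul_snd, inner_smul_right, smul_eq_mul, RingHom.id_apply]
      ring)

lemma kreinForm_apply (x y : WithLp 2 (E × F)) :
    kreinForm E F x y = inner ℂ x.fst y.fst - inner ℂ x.snd y.snd := rfl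

lemma kreinForm_self (x : WithLp 2 (E × F)) :
    kreinForm E F x x = ((‖x.fst‖ ^ 2 - ‖x.snd‖ ^ 2 : ℝ) : ℂ) := by
  rw [kreinForm_apply, inner_self_eq_norm_sq_to_K, inner_self_eq_norm_sq_to_K]
  push_cast; rfl

lemma norm_kreinForm_self_le (x : WithLp 2 (E × F)) : ‖kreinForm E F x x‖ ≤ ‖x‖ ^ 2 := by
  rw [kreinForm_self, Complex.norm_real, Real.norm_eq_abs, WithLp.prod_norm_sq_eq_of_L2, abs_le]
  constructor <;> nlinarith [sq_nonneg ‖x.fst‖, sq_nonneg ‖x.snd‖]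

lemma continuous_kreinForm :
    Continuous fun x : WithLp 2 (E × F) × WithLp 2 (E × F) => kreinForm E F x.1 x.2 := by
  simp only [kreinForm_apply]
  fun_prop

lemma isHermitianForm_kreinForm : IsHermitianForm (kreinForm E F) := fun x y => by
  simp only [kreinForm_apply, map_sub, inner_conj_symm]

variable (E F) in
/-- The positive component `E ⊕ 0`. -/
def kreinPos : Submodule ℂ (WithLp 2 (E × F)) :=
  LinearMap.ker (WithLp.sndL 2 ℂ E F).toLinearMap

variable (E F) in
/-- The negative component `0 ⊕ F`. -/
def kreinNeg : Submodule ℂ (WithLp 2 (E × F)) :=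
  LinearMap.ker (WithLp.fstL 2 ℂ E F).toLinearMap

lemma mem_kreinPos {x : WithLp 2 (E × F)} : x ∈ kreinPos E F ↔ x.snd = 0 := Iff.rfl

lemma mem_kreinNeg {x : WithLp 2 (E × F)} : x ∈ kreinNeg E F ↔ x.fst = 0 := Iff.rfl

lemma isClosed_kreinPos : IsClosed (kreinPos E F : Set (WithLp 2 (E × F))) :=
  (WithLp.sndL 2 ℂ E F).isClosed_ker

lemma isClosed_kreinNeg : IsClosed (kreinNeg E F : Set (WithLp 2 (E × F))) :=
  (WithLp.fstL 2 ℂ E F).isClosed_ker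

lemma isPosDefOn_kreinPos : IsPosDefOn (kreinForm E F) (kreinPos E F) := fun x hx hx0 => by
  rw [mem_kreinPos] at hx
  rw [kreinForm_self, Complex.ofReal_re, hx, norm_zero]
  have : x.fst ≠ 0 := fun h => hx0 (withLp_prod_ext h hx)
  have := norm_pos_iff.2 this
  nlinarith

lemma isNegDefOn_kreinNeg : IsNegDefOn (kreinForm E F) (kreinNeg E F) := fun x hx hx0 => by
  rw [mem_kreinNeg] at hx
  rw [kreinForm_self, Complex.ofReal_re, hx, norm_zero]
  have : x.snd ≠ 0 := fun h => hx0 (withLp_prod_ext hx h)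
  have := norm_pos_iff.2 this
  nlinarith

lemma isFundamentalDecomposition_kreinForm :
    IsFundamentalDecomposition (kreinForm E F) (kreinPos E F) (kreinNeg E F) := by
  refine ⟨⟨?_, ?_⟩, ?_, isPosDefOn_kreinPos, isNegDefOn_kreinNeg⟩
  · rw [Submodule.disjoint_def]
    exact fun x hx hx' => withLp_prod_ext hx' hx
  · rw [codisjoint_iff, Submodule.eq_top_iff']
    intro x
    refine Submodule.mem_sup.2 ⟨WithLp.toLp 2 (x.fst, 0), rfl, WithLp.toLp 2 (0, x.snd), rfl, ?_⟩
    exact withLp_prod_ext (add_zero _) (zero_add _)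
  · intro x hx y hy
    rw [mem_kreinPos] at hx
    rw [mem_kreinNeg] at hy
    simp [kreinForm_apply, hx, hy]

/-- The positive component is maximal positive definite. -/
lemma maximal_isPosDefOn_kreinPos : Maximal (IsPosDefOn (kreinForm E F)) (kreinPos E F) := by
  refine ⟨isPosDefOn_kreinPos, fun W hW hle x hx => ?_⟩
  -- As `W` contains `E ⊕ 0`, it contains the second component of each of its vectors, and `⟨·,·⟩`
  -- takes the value `-‖x.snd‖² ≤ 0` there.
  have h1 : (WithLp.toLp 2 (0, x.snd) : WithLp 2 (E × F)) ∈ W := by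
    have : (WithLp.toLp 2 (0, x.snd) : WithLp 2 (E × F)) = x - WithLp.toLp 2 (x.fst, 0) :=
      withLp_prod_ext (by simp) (by simp)
    rw [this]
    exact W.sub_mem hx (hle rfl)
  by_contra hne
  rw [mem_kreinPos] at hne
  have h2 := hW _ h1 fun h => hne (congrArg WithLp.snd h)
  rw [kreinForm_self, Complex.ofReal_re] at h2
  simp only [WithLp.toLp_fst, WithLp.toLp_snd, norm_zero] at h2
  nlinarith [sq_nonneg ‖x.snd‖]

lemma isIntrinsicallyComplete_of_isClosed [CompleteSpace E] [CompleteSpace F]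
    {W : Submodule ℂ (WithLp 2 (E × F))} (hW : IsClosed (W : Set (WithLp 2 (E × F))))
    (h : ∀ x ∈ W, ‖kreinForm E F x x‖ = ‖x‖ ^ 2) :
    IsIntrinsicallyComplete (kreinForm E F) W := by
  intro u hu hcau
  have hc : CauchySeq u := by
    rw [Metric.cauchySeq_iff]
    intro ε hε
    obtain ⟨N, hN⟩ := hcau (ε ^ 2) (by positivity)
    refine ⟨N, fun m hm n hn => ?_⟩
    have := hN m hm n hn
    rw [h _ (W.sub_mem (hu m) (hu n))] at this
    rw [dist_eq_norm]
    exact lt_of_pow_lt_pow_left₀ 2 hε.le this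
  obtain ⟨x, hx⟩ := cauchySeq_tendsto_of_complete hc
  have hxW : x ∈ W := hW.mem_of_tendsto hx (Eventually.of_forall hu)
  refine ⟨x, hxW, ?_⟩
  simp only [fun n => h _ (W.sub_mem (hu n) hxW)]
  simpa using (tendsto_iff_norm_sub_tendsto_zero.1 hx).pow 2

lemma isKreinSpace_kreinForm [CompleteSpace E] [CompleteSpace F] :
    IsKreinSpace (kreinForm E F) := by
  refine ⟨isHermitianForm_kreinForm, fun x hx => ?_, kreinPos E F, kreinNeg E F,
    isFundamentalDecomposition_kreinForm,
    isIntrinsicallyComplete_of_isClosed isClosed_kreinPos fun x hx => ?_,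
    isIntrinsicallyComplete_of_isClosed isClosed_kreinNeg fun x hx => ?_⟩
  · refine withLp_prod_ext ?_ ?_
    · have := hx (WithLp.toLp 2 (x.fst, 0))
      simpa [kreinForm_apply] using this
    · have := hx (WithLp.toLp 2 (0, x.snd))
      simpa [kreinForm_apply] using this
  · rw [mem_kreinPos] at hx
    rw [kreinForm_self, Complex.norm_real, WithLp.prod_norm_sq_eq_of_L2, hx]
    simp
  · rw [mem_kreinNeg] at hx
    rw [kreinForm_self, Complex.norm_real, WithLp.prod_norm_sq_eq_of_L2, hx]
    simp

/-! ### The rank of negativity -/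

/-- Gram-Schmidt applied to an algebraic basis of the span of the dense sequence. The span has
countable dimension, and infinite dimension because a finite-dimensional dense subspace is closed,
hence everything. -/
lemma exists_orthonormal_dense_span {M : Type*} [NormedAddCommGroup M] [InnerProductSpace ℂ M]
    {u : ℕ → M} (hu : DenseRange u) (hinf : ¬ Module.Finite ℂ M) :
    ∃ e : ℕ → M, Orthonormal ℂ e ∧ Dense (Submodule.span ℂ (Set.range e) : Set M) := by
  set S := Submodule.span ℂ (Set.range u)
  have hSd : Dense (S : Set M) := hu.mono Submodule.subset_span
  have hSinf : ¬ Module.Finite ℂ S := by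
    intro hfin
    have : S = ⊤ := by
      rw [← S.closed_of_finiteDimensional.submodule_topologicalClosure_eq,
        ← Submodule.dense_iff_topologicalClosure_eq_top]
      exact hSd
    rw [this] at hfin
    exact hinf (Module.Finite.equiv Submodule.topEquiv)
  let b := Module.Basis.ofVectorSpace ℂ S
  have hcard : Cardinal.mk (Module.Basis.ofVectorSpaceIndex ℂ S) = Cardinal.aleph0 := by
    rw [b.mk_eq_rank'']
    apply le_antisymm
    · exact (rank_span_le _).trans (Cardinal.mk_le_aleph0_iff.2 (Set.countable_range u))
    · rw [← not_lt, Module.rank_lt_aleph0_iff]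
      exact hSinf
  obtain ⟨hden⟩ := Cardinal.denumerable_iff.2 hcard
  let b' : Module.Basis ℕ ℂ S := b.reindex (Denumerable.eqv _)
  let v : ℕ → M := fun n => (b' n : M)
  have hv : LinearIndependent ℂ v := b'.linearIndependent.map' S.subtype S.ker_subtype
  have hspan : Submodule.span ℂ (Set.range v) = S := by
    have h1 : Set.range v = S.subtype '' Set.range b' := by
      rw [← Set.range_comp]; rfl
    rw [h1, ← Submodule.map_span, b'.span_eq, Submodule.map_top, Submodule.range_subtype]
  refine ⟨InnerProductSpace.gramSchmidtNormed ℂ v,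
    InnerProductSpace.gramSchmidtNormed_orthonormal hv, ?_⟩
  rw [InnerProductSpace.span_gramSchmidtNormed_range, InnerProductSpace.span_gramSchmidt, hspan]
  exact hSd

/-- Meant for the negative part of an arbitrary fundamental decomposition, whose intrinsic norm is
not the norm inherited from the Hilbert space. The inner product is therefore passed as a `Core`,
and the norm it defines stays local to the proof. -/
lemma exists_orthonormal_of_core {M : Type*} [AddCommGroup M] [Module ℂ M]
    (core : InnerProductSpace.Core ℂ M) {u : ℕ → M}
    (hu : ∀ x, ∀ ε > 0, ∃ n, ‖core.inner (x - u n) (x - u n)‖ < ε)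
    (hinf : ¬ Module.Finite ℂ M) :
    ∃ e : ℕ → M, (∀ m n, core.inner (e m) (e n) = if m = n then 1 else 0) ∧
      ∀ x, ∀ ε > 0, ∃ y ∈ Submodule.span ℂ (Set.range e), ‖core.inner (x - y) (x - y)‖ < ε := by
  let : NormedAddCommGroup M := core.toNormedAddCommGroup
  let : InnerProductSpace ℂ M := InnerProductSpace.ofCore core.toCore
  have hin : ∀ x : M, ‖core.inner x x‖ = ‖x‖ ^ 2 := fun x => by
    have h : core.inner x x = inner ℂ x x := rfl
    rw [h, inner_self_eq_norm_sq_to_K]; simp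
  have hd : DenseRange u := by
    refine Metric.denseRange_iff.2 fun x r hr => ?_
    obtain ⟨n, hn⟩ := hu x (r ^ 2) (by positivity)
    rw [hin] at hn
    exact ⟨n, by rw [dist_eq_norm]; exact lt_of_pow_lt_pow_left₀ 2 hr.le hn⟩
  obtain ⟨e, he, hde⟩ := exists_orthonormal_dense_span hd hinf
  refine ⟨e, fun m n => orthonormal_iff_ite.1 he m n, fun x ε hε => ?_⟩
  obtain ⟨y, hy, hxy⟩ := Metric.dense_iff.1 hde x (Real.sqrt ε) (Real.sqrt_pos.2 hε)
  refine ⟨y, hxy, ?_⟩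
  rw [hin]
  rw [Metric.mem_ball, dist_comm, dist_eq_norm] at hy
  calc ‖x - y‖ ^ 2 < Real.sqrt ε ^ 2 := by gcongr
    _ = ε := Real.sq_sqrt hε.le

/-- Minus the inner product, as a positive definite inner product on a negative definite
subspace. -/
@[reducible] noncomputable def negDefCore {Km : Submodule ℂ (WithLp 2 (E × F))}
    (h : IsNegDefOn (kreinForm E F) Km) : InnerProductSpace.Core ℂ Km where
  inner x y := -kreinForm E F x y
  conj_inner_symm x y := by
    simp only [map_neg]
    rw [← isHermitianForm_kreinForm]
  re_inner_nonneg x := by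
    by_cases hx : (x : WithLp 2 (E × F)) = 0
    · simp [hx]
    · have := h x x.2 hx
      simp only [map_neg, RCLike.re_to_complex]
      linarith
  add_left x y z := by simp only [Submodule.coe_add, map_add, LinearMap.add_apply]; ring
  smul_left x y r := by
    simp only [Submodule.coe_smul, LinearMap.map_smulₛₗ, LinearMap.smul_apply, smul_eq_mul]; ring
  definite x hx := by
    by_contra hx0
    have := h x x.2 fun h0 => hx0 (Subtype.ext h0)
    rw [neg_eq_zero.1 hx] at this
    simp at this

/-- `Km` is infinite-dimensional because `0 ⊕ F` projects injectively into it along `Kp`: a vector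
in the kernel lies in `Kp`, yet has `⟨x, x⟩ ≤ 0`. Its intrinsic norm is at most the Hilbert norm, so
a sequence dense in `Km` for the latter is dense for the former. -/
lemma hasCountablyInfiniteNegativityRank_kreinForm [TopologicalSpace.SeparableSpace E]
    [TopologicalSpace.SeparableSpace F] (hF : ¬ Module.Finite ℂ F) :
    HasCountablyInfiniteNegativityRank (kreinForm E F) := by
  rintro Kp Km ⟨hcompl, -, hpos, hneg⟩
  have hinf : ¬ Module.Finite ℂ Km := by
    intro hfin
    let inr : F →ₗ[ℂ] WithLp 2 (E × F) :=
      (WithLp.linearEquiv 2 ℂ (E × F)).symm.toLinearMap ∘ₗ LinearMap.inr ℂ E F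
    have hinj : Function.Injective (Km.projectionOnto Kp hcompl.symm ∘ₗ inr) := by
      rw [← LinearMap.ker_eq_bot, Submodule.eq_bot_iff]
      intro y hy
      have hy' : inr y ∈ Kp := by
        have : inr y ∈ LinearMap.ker (Km.projectionOnto Kp hcompl.symm) := hy
        simpa using this
      by_contra hy0
      have h1 := hpos _ hy' fun h => hy0 (congrArg WithLp.snd h)
      rw [kreinForm_self, Complex.ofReal_re] at h1
      have e1 : (inr y).fst = 0 := rfl
      rw [e1, norm_zero] at h1
      nlinarith [sq_nonneg ‖(inr y).snd‖]
    exact hF (Module.Finite.of_injective _ hinj)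
  have : SecondCountableTopology E := UniformSpace.secondCountable_of_separable E
  have : SecondCountableTopology F := UniformSpace.secondCountable_of_separable F
  have : SecondCountableTopology (WithLp 2 (E × F)) :=
    (WithLp.prodContinuousLinearEquiv 2 ℂ E F).toHomeomorph.secondCountableTopology
  obtain ⟨u, hu⟩ := TopologicalSpace.exists_dense_seq Km
  obtain ⟨e, he, hd⟩ := exists_orthonormal_of_core (negDefCore hneg) (u := u)
    (fun x ε hε => by
      obtain ⟨n, hn⟩ := hu.exists_dist_lt x (Real.sqrt_pos.2 hε)
      refine ⟨n, ?_⟩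
      rw [dist_eq_norm] at hn
      calc ‖-kreinForm E F (x - u n : Km) (x - u n : Km)‖ ≤ ‖x - u n‖ ^ 2 := by
            rw [norm_neg]; exact norm_kreinForm_self_le _
        _ < Real.sqrt ε ^ 2 := by gcongr
        _ = ε := Real.sq_sqrt hε.le) hinf
  refine ⟨fun n => e n, fun n => (e n).2, fun m n => ?_, fun x hx ε hε => ?_⟩
  · have h : -kreinForm E F (e m) (e n) = if m = n then 1 else 0 := he m n
    rw [neg_eq_iff_eq_neg] at h
    rw [h]
    split_ifs <;> simp
  · obtain ⟨y, hy, hlt⟩ := hd ⟨x, hx⟩ ε hε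
    refine ⟨y, ?_, ?_⟩
    · have h1 : Set.range (fun n => (e n : WithLp 2 (E × F))) = Km.subtype '' Set.range e := by
        rw [← Set.range_comp]; rfl
      rw [h1, ← Submodule.map_span]
      exact ⟨y, hy, rfl⟩
    · exact (norm_neg _).symm.trans_lt hlt

/-! ### Minimal majorants -/

/-- Let `t'` be a weaker majorant. Joint continuity gives `t'`-neighbourhoods `p`, `p'` of `0` with
`|⟨f, g⟩| < 1` on `p × p'`. Since `t'` is weaker, `p'` contains the trace of a Hilbert ball; by
duality `p` is then bounded in the Hilbert norm, so `ι` is `t'`-continuous and the topologies agree.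
-/
lemma isMinimalMajorant_induced {V : Type*} [AddCommGroup V] [Module ℂ V]
    (ι : V →ₗ[ℂ] WithLp 2 (E × F)) (hι : DenseRange ι) :
    IsMinimalMajorant (fun f g => kreinForm E F (ι f) (ι g))
      (TopologicalSpace.induced ι inferInstance) := by
  constructor
  · refine ⟨topologicalAddGroup_induced ι, continuousSMul_induced ι, ?_, ?_⟩
    · exact LocallyConvexSpace.induced (𝕜 := ℝ) (ι.restrictScalars ℝ)
    · let _ : TopologicalSpace V := TopologicalSpace.induced ι inferInstance
      have hc : Continuous ι := continuous_induced_dom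
      exact continuous_kreinForm.comp (hc.prodMap hc)
  · rintro t' ⟨h1, h2, -, hQ⟩ hle
    refine le_antisymm ?_ hle
    rw [← continuous_iff_le_induced]
    have hev : ∀ᶠ p in 𝓝 (0 : V) ×ˢ 𝓝 (0 : V), ‖kreinForm E F (ι p.1) (ι p.2)‖ < 1 := by
      rw [← nhds_prod_eq]
      refine hQ.norm.tendsto (0 : V × V) |>.eventually (gt_mem_nhds ?_)
      simp
    obtain ⟨p, hp, p', hp', hpp⟩ := eventually_prod_iff.1 hev
    have hp'' := nhds_mono hle hp'
    rw [nhds_induced, map_zero] at hp''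
    obtain ⟨s, hs, hsp⟩ := hp''
    obtain ⟨r, hr, hrs⟩ := Metric.mem_nhds_iff.1 hs
    have hbound : ∀ f, p f → ‖ι f‖ ≤ 2 / r := by
      intro f hf
      have h3 : ∀ y ∈ Metric.ball (0 : WithLp 2 (E × F)) r, ‖kreinForm E F (ι f) y‖ ≤ 1 := by
        intro y hy
        -- The bound on the image of `V` extends to the whole open ball by density, the strict
        -- inequality becoming weak.
        have hcl : IsClosed {y | ‖kreinForm E F (ι f) y‖ ≤ 1} :=
          isClosed_le (continuous_kreinForm.comp (Continuous.prodMk_right (ι f))).norm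
            continuous_const
        refine closure_minimal ?_ hcl (hι.open_subset_closure_inter Metric.isOpen_ball hy)
        rintro _ ⟨hg, g, rfl⟩
        exact (hpp hf (hsp (hrs hg))).le
      rcases eq_or_ne (ι f) 0 with h0 | h0
      · rw [h0, norm_zero]; positivity
      have hpos : 0 < ‖ι f‖ := norm_pos_iff.2 h0
      -- `z` is the image of `ι f` under the fundamental symmetry, so `⟨ι f, z⟩ = ‖ι f‖²`. The
      -- factor `r / (2 ‖ι f‖)` used below puts it inside the open ball.
      let z : WithLp 2 (E × F) := WithLp.toLp 2 ((ι f).fst, -(ι f).snd)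
      have hz : ‖z‖ = ‖ι f‖ := by
        rw [← sq_eq_sq₀ (norm_nonneg _) (norm_nonneg _), WithLp.prod_norm_sq_eq_of_L2,
          WithLp.prod_norm_sq_eq_of_L2]
        simp [z]
      have hBz : kreinForm E F (ι f) z = ((‖ι f‖ ^ 2 : ℝ) : ℂ) := by
        rw [WithLp.prod_norm_sq_eq_of_L2, kreinForm_apply]
        simp [z, inner_self_eq_norm_sq_to_K]
      have h4 := h3 (((r / (2 * ‖ι f‖) : ℝ) : ℂ) • z) (by
        rw [mem_ball_zero_iff, norm_smul, hz, Complex.norm_real, Real.norm_of_nonneg (by positivity)]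
        field_simp
        norm_num)
      rw [map_smul, hBz, smul_eq_mul, ← Complex.ofReal_mul, Complex.norm_real,
        Real.norm_of_nonneg (by positivity)] at h4
      rw [le_div_iff₀ hr]
      have : r / (2 * ‖ι f‖) * ‖ι f‖ ^ 2 = ‖ι f‖ * r / 2 := by field_simp
      linarith
    refine continuous_of_continuousAt_zero ι ?_
    rw [ContinuousAt, map_zero, Metric.tendsto_nhds]
    intro ε hε
    -- Scaling by `4 / (r ε)` turns the bound `2 / r` into `‖ι f‖ ≤ ε / 2 < ε`.
    have ha : (0 : ℝ) < 4 / (r * ε) := by positivity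
    have hsm : Tendsto (fun f : V => ((4 / (r * ε) : ℝ) : ℂ) • f) (𝓝 0) (𝓝 0) := by
      have := (continuous_const_smul ((4 / (r * ε) : ℝ) : ℂ)).tendsto (0 : V)
      rwa [smul_zero] at this
    filter_upwards [hsm.eventually hp] with f hf
    have h5 := hbound _ hf
    rw [map_smul, norm_smul, Complex.norm_real, Real.norm_of_nonneg ha.le] at h5
    rw [dist_zero_right]
    rw [div_mul_eq_mul_div, div_le_div_iff₀ (by positivity) hr] at h5
    have h6 : 4 * ‖ι f‖ ≤ 2 * ε := by
      have : 4 * ‖ι f‖ * r ≤ 2 * ε * r := by linarith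
      exact le_of_mul_le_mul_right this hr
    linarith

end Krein

/-! ## Decay of the Taylor coefficients of the symbol -/

/-- Square summability of `c` against all sequences `E ^ k k ^ (k β)`. -/
def IsGevreySummable (β : ℝ) (c : ℕ → ℝ) : Prop :=
  ∀ E > 0, Summable fun k : ℕ => (c k * (E ^ k * (k : ℝ) ^ ((k : ℝ) * β))) ^ 2

/-- Cauchy's estimate on the circle of radius `k^(2δ)`, chosen so that `exp (|ξ|^(1/(2δ)))` equals
`e^k` there. The terms are then at most `C (e E² k^(-2(δ-β)))^k`, and the base tends to `0`. -/
lemma isGevreySummable_of_isInfraExponential {β δ : ℝ} (hβ : 0 ≤ β) (hδ : β < δ) {J : ℂ → ℂ}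
    (hJ : IsInfraExponential J (1 / (2 * δ))) {c : ℕ → ℝ}
    (hJc : ∀ k : ℕ, iteratedDeriv k J 0 / (k ! : ℂ) = ((c k ^ 2 : ℝ) : ℂ)) :
    IsGevreySummable β c := by
  intro E hE
  have hδ0 : 0 < δ := hβ.trans_lt hδ
  obtain ⟨C, hC, hbound⟩ := hJ.2 1 one_pos
  have hck : ∀ k : ℕ, 0 < k → c k ^ 2 ≤ C * Real.exp 1 ^ k / ((k : ℝ) ^ (2 * δ)) ^ k := by
    intro k hk
    have hk' : (0 : ℝ) < k := by exact_mod_cast hk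
    have h1 := Complex.norm_iteratedDeriv_le_of_forall_mem_sphere_norm_le (c := 0)
      (R := (k : ℝ) ^ (2 * δ)) (C := C * Real.exp 1 ^ k) k (by positivity)
      hJ.1.diffContOnCl fun z hz => by
        rw [mem_sphere_zero_iff_norm] at hz
        refine (hbound z).trans (le_of_eq ?_)
        rw [hz, ← Real.rpow_mul hk'.le, mul_one_div_cancel (by positivity), Real.rpow_one, one_mul,
          ← Real.exp_nat_mul, mul_one]
    have h2 : c k ^ 2 = ‖iteratedDeriv k J 0‖ / k ! := by
      rw [← Complex.norm_natCast, ← norm_div, hJc, Complex.norm_real,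
        Real.norm_of_nonneg (sq_nonneg _)]
    rw [h2, div_le_iff₀ (by positivity)]
    calc _ ≤ _ := h1
      _ = _ := by ring
  have hlim : Tendsto (fun k : ℕ => Real.exp 1 * E ^ 2 * (k : ℝ) ^ (-(2 * (δ - β)))) atTop
      (𝓝 0) := by
    have := ((tendsto_rpow_neg_atTop (y := 2 * (δ - β)) (by linarith)).comp
      tendsto_natCast_atTop_atTop).const_mul (Real.exp 1 * E ^ 2)
    simpa using this
  refine Summable.of_norm_bounded_eventually_nat
    ((summable_geometric_of_lt_one (by norm_num) (by norm_num : (1 / 2 : ℝ) < 1)).mul_left C) ?_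
  filter_upwards [hlim.eventually (ge_mem_nhds (by norm_num : (0 : ℝ) < 1 / 2)),
    eventually_gt_atTop 0] with k hk hk0
  have hk' : (0 : ℝ) < k := by exact_mod_cast hk0
  rw [Real.norm_of_nonneg (sq_nonneg _), mul_pow]
  have h3 : (E ^ k * (k : ℝ) ^ ((k : ℝ) * β)) ^ 2 = (E ^ 2 * (k : ℝ) ^ (2 * β)) ^ k := by
    rw [mul_pow, mul_pow, ← pow_mul, ← pow_mul, mul_comm 2 k,
      ← Real.rpow_natCast ((k : ℝ) ^ ((k : ℝ) * β)), ← Real.rpow_mul hk'.le,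
      ← Real.rpow_natCast ((k : ℝ) ^ (2 * β)), ← Real.rpow_mul hk'.le]
    congr 2; push_cast; ring
  have h4 : (k : ℝ) ^ (-(2 * (δ - β))) = (k : ℝ) ^ (2 * β) / (k : ℝ) ^ (2 * δ) := by
    rw [← Real.rpow_sub hk']; congr 1; ring
  calc c k ^ 2 * (E ^ k * (k : ℝ) ^ ((k : ℝ) * β)) ^ 2
      ≤ C * Real.exp 1 ^ k / ((k : ℝ) ^ (2 * δ)) ^ k * (E ^ 2 * (k : ℝ) ^ (2 * β)) ^ k := by
        rw [h3]; gcongr; exact hck k hk0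
    _ = C * (Real.exp 1 * E ^ 2 * (k : ℝ) ^ (-(2 * (δ - β)))) ^ k := by
        rw [h4]; simp only [mul_pow, div_pow]; ring
    _ ≤ C * (1 / 2) ^ k := by gcongr

/-! ## The embedding into the Krein space -/

lemma exists_norm_iteratedDeriv_zero_le {α : ℝ≥0∞} {β : ℝ≥0} (f : gelfandShilov α β) :
    ∃ C > 0, ∃ B ≥ 1, ∀ k : ℕ,
      ‖iteratedDeriv k f.1 0‖ ≤ C * (B ^ k * (k : ℝ) ^ ((k : ℝ) * (β : ℝ))) := by
  obtain ⟨-, a, b, ha, hb, h⟩ := f.2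
  obtain ⟨C, hC, B, hB, hb'⟩ := hb.exists_one_le ENNReal.coe_ne_top
  have ha0 := ha.1 0
  refine ⟨(a 0 + 1) * C, by positivity, B, hB, fun k => ?_⟩
  have h1 := h 0 k 0
  simp only [Complex.ofReal_zero, pow_zero, one_mul] at h1
  calc _ ≤ a 0 * b k := h1
    _ ≤ (a 0 + 1) * (C * B ^ k * (k : ℝ) ^ ((k : ℝ) * (β : ℝ))) :=
        mul_le_mul (by linarith) (hb' k) (hb.1 k) (by positivity)
    _ = _ := by ring

lemma memℓp_two_of_norm_le {v : ℕ → ℂ} {w : ℕ → ℝ} (hw : Summable fun k => w k ^ 2)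
    (h : ∀ k, ‖v k‖ ≤ |w k|) : Memℓp v 2 := by
  refine memℓp_gen ?_
  simp only [ENNReal.toReal_ofNat, Real.rpow_ofNat]
  refine hw.of_nonneg_of_le (fun k => by positivity) fun k => ?_
  rw [← sq_abs (w k)]
  exact pow_le_pow_left₀ (norm_nonneg _) (h k) 2

lemma memℓp_jet {α : ℝ≥0∞} {β : ℝ≥0} {c : ℕ → ℝ} (hc : IsGevreySummable β c)
    (f : gelfandShilov α β) : Memℓp (fun k => (c k : ℂ) * iteratedDeriv k f.1 0) 2 := by
  obtain ⟨C, hC, B, hB, h⟩ := exists_norm_iteratedDeriv_zero_le f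
  refine memℓp_two_of_norm_le
    (w := fun k => C * (c k * (B ^ k * (k : ℝ) ^ ((k : ℝ) * (β : ℝ))))) ?_ fun k => ?_
  · simp only [mul_pow C]
    exact (hc B (by linarith)).mul_left _
  · have hw : 0 ≤ B ^ k * (k : ℝ) ^ ((k : ℝ) * (β : ℝ)) := by positivity
    rw [norm_mul, Complex.norm_real, Real.norm_eq_abs, abs_mul, abs_mul, abs_of_pos hC,
      abs_of_nonneg hw, mul_left_comm]
    exact mul_le_mul_of_nonneg_left (h k) (abs_nonneg _)

/-- The weighted Taylor coefficients `c_k f⁽ᵏ⁾(0)`, as a square summable sequence. -/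
noncomputable def jetMap (α : ℝ≥0∞) {β : ℝ≥0} {c : ℕ → ℝ} (hc : IsGevreySummable β c) :
    gelfandShilov α β →ₗ[ℂ] lp (fun _ : ℕ => ℂ) 2 where
  toFun f := ⟨fun k => (c k : ℂ) * iteratedDeriv k f.1 0, memℓp_jet hc f⟩
  map_add' f g := by
    ext k
    change (c k : ℂ) * iteratedDeriv k (f.1 + g.1) 0
      = c k * iteratedDeriv k f.1 0 + c k * iteratedDeriv k g.1 0
    rw [iteratedDeriv_add ((f.2.1.of_le (by exact_mod_cast le_top)).contDiffAt)
      ((g.2.1.of_le (by exact_mod_cast le_top)).contDiffAt), mul_add]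
  map_smul' a f := by
    ext k
    change (c k : ℂ) * iteratedDeriv k (a • f.1) 0 = a * (c k * iteratedDeriv k f.1 0)
    rw [iteratedDeriv_const_smul ((f.2.1.of_le (by exact_mod_cast le_top)).contDiffAt),
      smul_eq_mul, mul_left_comm]

section Embedding

variable {α : ℝ≥0∞} {β : ℝ≥0} {c : ℕ → ℝ}

lemma jetMap_apply (hc : IsGevreySummable β c) (f : gelfandShilov α β) (k : ℕ) :
    jetMap α hc f k = (c k : ℂ) * iteratedDeriv k f.1 0 := rfl

lemma inner_jetMap_apply (hc : IsGevreySummable β c) (f g : gelfandShilov α β) (k : ℕ) :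
    inner ℂ (jetMap α hc f k) (jetMap α hc g k)
      = ((c k ^ 2 : ℝ) : ℂ) * conj (iteratedDeriv k f.1 0) * iteratedDeriv k g.1 0 := by
  rw [RCLike.inner_apply, jetMap_apply, jetMap_apply, map_mul, Complex.conj_ofReal]
  push_cast; ring

lemma jetMap_eq_zero_iff (hc : IsGevreySummable β c) (hc0 : ∀ k, c k ≠ 0)
    (f : gelfandShilov α β) : jetMap α hc f = 0 ↔ f ∈ flatGelfandShilov α β := by
  rw [mem_flatGelfandShilov]
  constructor
  · intro h k
    have h1 := jetMap_apply hc f k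
    rw [h] at h1
    exact (mul_eq_zero.1 h1.symm).resolve_left (Complex.ofReal_ne_zero.2 (hc0 k))
  · intro h
    ext k
    rw [jetMap_apply, h k, mul_zero]
    rfl

/-- The Krein space: the Hilbert sum of `L²` and `ℓ²`. -/
abbrev KreinL2 : Type := WithLp 2 (Lp ℂ 2 (volume : Measure ℝ) × lp (fun _ : ℕ => ℂ) 2)

/-- The embedding `f ↦ (f, (c_k f⁽ᵏ⁾(0))ₖ)` of the Gelfand-Shilov space in the Krein space. -/
noncomputable def kreinEmbedding (α : ℝ≥0∞) {β : ℝ≥0} {c : ℕ → ℝ} (hc : IsGevreySummable β c) :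
    gelfandShilov α β →ₗ[ℂ] KreinL2 :=
  (WithLp.linearEquiv 2 ℂ _).symm.toLinearMap ∘ₗ (gelfandShilovToL2 α β).prod (jetMap α hc)

@[simp] lemma kreinEmbedding_fst (hc : IsGevreySummable β c) (f : gelfandShilov α β) :
    (kreinEmbedding α hc f).fst = gelfandShilovToL2 α β f := rfl

@[simp] lemma kreinEmbedding_snd (hc : IsGevreySummable β c) (f : gelfandShilov α β) :
    (kreinEmbedding α hc f).snd = jetMap α hc f := rfl

lemma kreinForm_kreinEmbedding (hc : IsGevreySummable β c) (f g : gelfandShilov α β) :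
    kreinForm _ _ (kreinEmbedding α hc f) (kreinEmbedding α hc g) = indefProd c f g := by
  rw [kreinForm_apply, kreinEmbedding_fst, kreinEmbedding_fst, kreinEmbedding_snd,
    kreinEmbedding_snd, inner_gelfandShilovToL2, lp.inner_eq_tsum, indefProd]
  simp only [inner_jetMap_apply]

lemma indefProdConverges_gelfandShilov (hc : IsGevreySummable β c) (f g : gelfandShilov α β) :
    IndefProdConverges c f g := by
  refine ⟨integrable_conj_mul_gelfandShilov f g, ?_⟩
  have := lp.summable_inner (𝕜 := ℂ) (jetMap α hc f) (jetMap α hc g)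
  simpa only [inner_jetMap_apply] using this

lemma gelfandShilovToL2_injective (α β : ℝ≥0∞) : Function.Injective (gelfandShilovToL2 α β) := by
  intro f g h
  have h1 : f.1 =ᵐ[volume] g.1 :=
    (coeFn_gelfandShilovToL2 f).symm.trans ((Filter.EventuallyEq.of_eq (by rw [h])).trans
      (coeFn_gelfandShilovToL2 g))
  exact Subtype.ext ((Continuous.ae_eq_iff_eq volume f.2.1.continuous g.2.1.continuous).1 h1)

lemma kreinEmbedding_injective (hc : IsGevreySummable β c) :
    Function.Injective (kreinEmbedding α hc) := fun _ _ h =>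
  gelfandShilovToL2_injective α β (congrArg WithLp.fst h)

/-! ### Density -/

lemma iteratedDeriv_momentumOp (f : gelfandShilov α β) (k : ℕ) :
    iteratedDeriv k (momentumOp α β f).1 0 = k * iteratedDeriv (k - 1) f.1 0 := by
  have := iteratedDeriv_ofReal_mul f.2.1 k 0
  rw [Complex.ofReal_zero, zero_mul, zero_add] at this
  exact this

lemma iteratedDeriv_positionOp (f : gelfandShilov α β) (k : ℕ) :
    iteratedDeriv k (positionOp α β f).1 0 = Complex.I * iteratedDeriv (k + 1) f.1 0 := by
  change iteratedDeriv k (Complex.I • deriv f.1) 0 = _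
  rw [iteratedDeriv_const_smul
    (((contDiff_infty_iff_deriv.1 f.2.1).2.of_le (by exact_mod_cast le_top)).contDiffAt),
    smul_eq_mul, iteratedDeriv_succ']

lemma iteratedDeriv_momentumOp_pow_of_lt (f : gelfandShilov α β) {n k : ℕ} (hk : k < n) :
    iteratedDeriv k ((momentumOp α β ^ n) f).1 0 = 0 := by
  induction n generalizing k with
  | zero => omega
  | succ n ih =>
    rw [pow_succ', Module.End.mul_apply, iteratedDeriv_momentumOp]
    rcases k with _ | k
    · simp
    · rw [Nat.add_sub_cancel, ih (by omega), mul_zero]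

lemma iteratedDeriv_momentumOp_pow_self (f : gelfandShilov α β) (n : ℕ) :
    iteratedDeriv n ((momentumOp α β ^ n) f).1 0 = n ! * f.1 0 := by
  induction n with
  | zero => simp
  | succ n ih =>
    rw [pow_succ', Module.End.mul_apply, iteratedDeriv_momentumOp, Nat.add_sub_cancel, ih,
      Nat.factorial_succ]
    push_cast; ring

lemma IsGelfandShilov.comp_mul_left {α β : ℝ≥0∞} {f : ℝ → ℂ} (hf : IsGelfandShilov α β f)
    {l : ℝ} (hl : l ≠ 0) : IsGelfandShilov α β (fun x => f (l * x)) := by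
  obtain ⟨hf, a, b, ha, hb, h⟩ := hf
  refine ⟨hf.comp (contDiff_const.mul contDiff_id), _, _, ha.geom_mul (abs_nonneg l⁻¹),
    hb.geom_mul (abs_nonneg l), fun q k x => ?_⟩
  rw [iteratedDeriv_comp_const_smul (hf.of_le (by exact_mod_cast le_top)) l]
  have h1 : (x : ℂ) ^ q * l ^ k • iteratedDeriv k f (l * x)
      = ((l⁻¹ : ℝ) : ℂ) ^ q * (l : ℂ) ^ k * (((l * x : ℝ) : ℂ) ^ q * iteratedDeriv k f (l * x)) := by
    have hl' : (l : ℂ) ≠ 0 := Complex.ofReal_ne_zero.2 hl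
    rw [Complex.real_smul]
    push_cast
    rw [mul_pow, inv_pow]
    field_simp
  rw [h1, norm_mul, norm_mul, norm_pow, norm_pow, Complex.norm_real, Complex.norm_real,
    Real.norm_eq_abs, Real.norm_eq_abs]
  calc _ ≤ |l⁻¹| ^ q * |l| ^ k * (a q * b k) :=
        mul_le_mul_of_nonneg_left (h q k _) (by positivity)
    _ = _ := by ring

/-- Dilation isolates one coefficient. If the Taylor series of `h` starts in degree `m`, the jet of
`h (l x)` is `l^k` times that of `h` in degree `k`; after division by `l^m`, only the degree `m`
survives as `l → 0`. -/
lemma eq_zero_of_orthogonal_jetMap (hβ : 1 < β) (hc : IsGevreySummable β c)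
    (hc0 : ∀ k, c k ≠ 0) {a : lp (fun _ : ℕ => ℂ) 2}
    (ha : ∀ f : gelfandShilov α β, inner ℂ (jetMap α hc f) a = 0) : a = 0 := by
  ext m
  set h : gelfandShilov α β := (momentumOp α β ^ m) (gelfandShilovBump α hβ (-1) 1 1) with h_def
  have hlt : ∀ k < m, iteratedDeriv k h.1 0 = 0 := fun k hk =>
    iteratedDeriv_momentumOp_pow_of_lt _ hk
  have hm : iteratedDeriv m h.1 0 ≠ 0 := by
    rw [h_def, iteratedDeriv_momentumOp_pow_self]
    refine mul_ne_zero (by exact_mod_cast Nat.factorial_ne_zero m) ?_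
    exact gevreyBump_ne_zero (by simp) (by simp)
  let l : ℕ → ℝ := fun n => 1 / ((n : ℝ) + 1)
  have hl0 : ∀ n, 0 < l n := fun n => by simp only [l]; positivity
  have hl1 : ∀ n, l n ≤ 1 := fun n => by
    simp only [l]; rw [div_le_one (by positivity)]; linarith [(Nat.cast_nonneg n : (0 : ℝ) ≤ n)]
  have hlim : Tendsto l atTop (𝓝 0) := tendsto_one_div_add_atTop_nhds_zero_nat
  -- The truncated exponent `k - m` is harmless for `k < m`, where the jet of `h` vanishes.
  let F : ℕ → ℕ → ℂ := fun n k => ((l n ^ (k - m) : ℝ) : ℂ) * inner ℂ (jetMap α hc h k) (a k)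
  have hF : ∀ n, ∑' k, F n k = 0 := by
    intro n
    let hn : gelfandShilov α β := ⟨fun x => h.1 (l n * x), h.2.comp_mul_left (hl0 n).ne'⟩
    have h1 : ∀ k, jetMap α hc hn k = (l n : ℂ) ^ k * jetMap α hc h k := by
      intro k
      rw [jetMap_apply, jetMap_apply]
      change (c k : ℂ) * iteratedDeriv k (fun x => h.1 (l n * x)) 0 = _
      rw [iteratedDeriv_comp_const_smul (h.2.1.of_le (by exact_mod_cast le_top)) (l n)]
      simp only [mul_zero, Complex.real_smul]
      push_cast; ring
    have h2 : ∀ k, inner ℂ (jetMap α hc hn k) (a k) = (l n : ℂ) ^ m * F n k := by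
      intro k
      rw [h1]
      rcases lt_or_ge k m with hk | hk
      · simp [F, jetMap_apply, hlt k hk]
      · simp only [F, RCLike.inner_apply, map_mul, map_pow, Complex.conj_ofReal]
        obtain ⟨j, rfl⟩ := Nat.exists_eq_add_of_le hk
        rw [Nat.add_sub_cancel_left, pow_add]
        push_cast; ring
    have h3 := ha hn
    rw [lp.inner_eq_tsum] at h3
    simp only [h2, tsum_mul_left] at h3
    exact (mul_eq_zero.1 h3).resolve_left
      (pow_ne_zero _ (Complex.ofReal_ne_zero.2 (hl0 n).ne'))
  have hT : Tendsto (fun n => ∑' k, F n k) atTop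
      (𝓝 (∑' k, if k = m then inner ℂ (jetMap α hc h m) (a m) else 0)) := by
    refine tendsto_tsum_of_dominated_convergence
      (bound := fun k => ‖(inner ℂ (jetMap α hc h k) (a k) : ℂ)‖)
      (lp.summable_inner (𝕜 := ℂ) (jetMap α hc h) a).norm (fun k => ?_)
      (Eventually.of_forall fun n k => ?_)
    · rcases lt_trichotomy k m with hk | rfl | hk
      · simp [F, jetMap_apply, hlt k hk, hk.ne]
      · simp [F]
      · have h4 : Tendsto (fun n => l n ^ (k - m)) atTop (𝓝 0) := by
          have := hlim.pow (k - m)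
          rwa [zero_pow (by omega)] at this
        have h5 := ((Complex.continuous_ofReal.tendsto 0).comp h4).mul_const
          (inner ℂ (jetMap α hc h k) (a k))
        rw [Complex.ofReal_zero, zero_mul] at h5
        rw [if_neg hk.ne']
        exact h5
    · simp only [F]
      rw [norm_mul, Complex.norm_real, Real.norm_of_nonneg (pow_nonneg (hl0 n).le _)]
      exact mul_le_of_le_one_left (norm_nonneg _) (pow_le_one₀ (hl0 n).le (hl1 n))
  simp only [hF, tsum_ite_eq] at hT
  have h6 := tendsto_nhds_unique hT tendsto_const_nhds
  rw [RCLike.inner_apply, jetMap_apply, mul_eq_zero, map_eq_zero, mul_eq_zero] at h6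
  rcases h6 with h6 | h6 | h6
  · exact h6
  · exact absurd h6 (Complex.ofReal_ne_zero.2 (hc0 m))
  · exact absurd h6 hm

/-- Flat functions embed as `(f, 0)` and see only the `L²` component of an orthogonal vector; once
that is zero, the jets alone determine the other. -/
lemma denseRange_kreinEmbedding (hβ : 1 < β) (hc : IsGevreySummable β c) (hc0 : ∀ k, c k ≠ 0) :
    DenseRange (kreinEmbedding α hc) := by
  rw [DenseRange, ← LinearMap.coe_range, Submodule.dense_iff_topologicalClosure_eq_top,
    Submodule.topologicalClosure_eq_top_iff, Submodule.eq_bot_iff]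
  intro x hx
  have hx' : ∀ f : gelfandShilov α β, inner ℂ (gelfandShilovToL2 α β f) x.fst
      + inner ℂ (jetMap α hc f) x.snd = 0 := fun f => by
    have := (Submodule.mem_orthogonal _ _).1 hx _ ⟨f, rfl⟩
    rwa [WithLp.prod_inner_apply] at this
  have h1 : x.fst = 0 := by
    refine eq_zero_of_orthogonal_flat α hβ fun f hf => ?_
    have := hx' f
    rwa [(jetMap_eq_zero_iff hc hc0 f).2 hf, inner_zero_left, add_zero] at this
  refine withLp_prod_ext h1 (eq_zero_of_orthogonal_jetMap hβ hc hc0 (α := α) fun f => ?_)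
  have := hx' f
  rwa [h1, inner_zero_right, zero_add] at this

/-! ### The Krein space is a maximal completion -/

instance separableSpace_lp_two : TopologicalSpace.SeparableSpace (lp (fun _ : ℕ => ℂ) 2) := by
  rw [← TopologicalSpace.isSeparable_univ_iff]
  set S := Submodule.span ℂ (Set.range fun i : ℕ => lp.single (E := fun _ : ℕ => ℂ) 2 i (1 : ℂ))
  have hS : Dense (S : Set (lp (fun _ : ℕ => ℂ) 2)) := by
    rw [Submodule.dense_iff_topologicalClosure_eq_top, Submodule.topologicalClosure_eq_top_iff,
      Submodule.eq_bot_iff]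
    intro x hx
    ext i
    have := (Submodule.mem_orthogonal _ _).1 hx _ (Submodule.subset_span ⟨i, rfl⟩)
    rw [lp.inner_single_left, RCLike.inner_apply] at this
    simpa using this
  rw [← hS.closure_eq]
  exact (TopologicalSpace.IsSeparable.span (Set.countable_range _).isSeparable).closure

lemma not_finite_lp_two : ¬ Module.Finite ℂ (lp (fun _ : ℕ => ℂ) 2) := by
  intro h
  have hli : LinearIndependent ℂ
      fun i : ℕ => lp.single (E := fun _ : ℕ => ℂ) 2 i (1 : ℂ) := by
    refine Orthonormal.linearIndependent (𝕜 := ℂ) ?_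
    rw [orthonormal_iff_ite]
    intro i j
    rw [lp.inner_single_left, RCLike.inner_apply, lp.single_apply, Pi.single_apply]
    split_ifs <;> simp
  have := hli.lt_aleph0_of_finite
  simp at this

lemma isMaximalKreinCompletion_kreinEmbedding (hβ : 1 < β) (hc : IsGevreySummable β c)
    (hc0 : ∀ k, c k ≠ 0) :
    IsMaximalKreinCompletion (fun f g : gelfandShilov α β => indefProd c f g) (kreinForm _ _)
      (kreinEmbedding α hc) where
  injective := kreinEmbedding_injective hc
  denseRange := denseRange_kreinEmbedding hβ hc hc0
  isometric := kreinForm_kreinEmbedding hc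
  continuous := continuous_kreinForm
  krein := isKreinSpace_kreinForm
  minimal := by
    have := isMinimalMajorant_induced _ (denseRange_kreinEmbedding (α := α) hβ hc hc0)
    simp only [kreinForm_kreinEmbedding] at this
    exact this

end Embedding

/-! ## Invariant subspaces consist of limits of flat functions -/

/-- Log-convexity makes the ratios `s (n + 1) / s n` nondecreasing, so `s n ≥ s 0 * r ^ n` with `r =
s 1 / s 0`; if `s 1 ≠ 0`, this contradicts the decay. -/
lemma eq_zero_of_log_convex_of_superexponential_decay {s : ℕ → ℝ} (h0 : ∀ n, 0 ≤ s n)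
    (hconv : ∀ n, s (n + 1) ^ 2 ≤ s n * s (n + 2))
    (hdecay : ∀ R ≥ (1 : ℝ), ∃ M, ∀ n, s n * R ^ n ≤ M) : s 1 = 0 := by
  by_contra h1
  have h1' : 0 < s 1 := lt_of_le_of_ne (h0 1) (Ne.symm h1)
  have h00 : 0 < s 0 := by
    rcases (h0 0).eq_or_lt with h | h
    · have := hconv 0
      rw [← h] at this
      nlinarith
    · exact h
  set r := s 1 / s 0 with hr
  have hr0 : 0 < r := by positivity
  have hstep : ∀ n, 0 < s n ∧ r * s n ≤ s (n + 1) := by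
    intro n
    induction n with
    | zero => exact ⟨h00, by rw [hr, div_mul_cancel₀ _ h00.ne']⟩
    | succ n ih =>
      obtain ⟨hn, hle⟩ := ih
      have hn1 : 0 < s (n + 1) := lt_of_lt_of_le (by positivity) hle
      refine ⟨hn1, ?_⟩
      have := hconv n
      refine le_of_mul_le_mul_left ?_ hn
      calc s n * (r * s (n + 1)) = (r * s n) * s (n + 1) := by ring
        _ ≤ s (n + 1) * s (n + 1) := by gcongr
        _ ≤ s n * s (n + 1 + 1) := by rw [← sq]; exact this
  have hpow : ∀ n, s 0 * r ^ n ≤ s n := by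
    intro n
    induction n with
    | zero => simp
    | succ n ih =>
      calc s 0 * r ^ (n + 1) = r * (s 0 * r ^ n) := by ring
        _ ≤ r * s n := by gcongr
        _ ≤ _ := (hstep n).2
  -- The choice `R ≥ 2 / r` turns the lower bound `s 0 * r ^ n` into `s 0 * 2 ^ n`, which is
  -- unbounded.
  obtain ⟨M, hM⟩ := hdecay (max 1 (2 / r)) (le_max_left _ _)
  have hM2 : ∀ n, s 0 * 2 ^ n ≤ M := by
    intro n
    calc s 0 * 2 ^ n = (s 0 * r ^ n) * (2 / r) ^ n := by
          rw [mul_assoc, ← mul_pow, mul_div_cancel₀ _ hr0.ne']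
      _ ≤ s n * (max 1 (2 / r)) ^ n := by
          gcongr
          · exact h0 n
          · exact hpow n
          · exact le_max_right _ _
      _ ≤ M := hM n
  obtain ⟨n, hn⟩ := pow_unbounded_of_one_lt (M / s 0) (one_lt_two (α := ℝ))
  rw [div_lt_iff₀ h00] at hn
  linarith [hM2 n]

section Invariant

variable {α : ℝ≥0∞} {β : ℝ≥0} {c : ℕ → ℝ}

/-- The constants do not depend on `n`: multiplication by `x` replaces `f⁽ᵏ⁾(0)` by `k f⁽ᵏ⁻¹⁾(0)`,
and for `β ≥ 1` the weight `k^(kβ)` absorbs the factor `k`. -/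
lemma norm_iteratedDeriv_momentumOp_pow_le (hβ : 1 ≤ β) {f : gelfandShilov α β} {C B : ℝ}
    (hC : 0 < C) (hB : 1 ≤ B)
    (h : ∀ k : ℕ, ‖iteratedDeriv k f.1 0‖ ≤ C * (B ^ k * (k : ℝ) ^ ((k : ℝ) * (β : ℝ)))) (n k : ℕ) :
    ‖iteratedDeriv k ((momentumOp α β ^ n) f).1 0‖
      ≤ C * (B ^ k * (k : ℝ) ^ ((k : ℝ) * (β : ℝ))) := by
  induction n generalizing k with
  | zero => exact h k
  | succ n ih =>
    rw [pow_succ', Module.End.mul_apply, iteratedDeriv_momentumOp]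
    rcases k with _ | k
    · simp; positivity
    rw [Nat.add_sub_cancel, norm_mul, Complex.norm_natCast]
    have hβ' : (1 : ℝ) ≤ β := by exact_mod_cast hβ
    have hk1 : (1 : ℝ) ≤ ((k + 1 : ℕ) : ℝ) := by push_cast; linarith [(k.cast_nonneg : (0 : ℝ) ≤ k)]
    have hw : ((k + 1 : ℕ) : ℝ) * (k : ℝ) ^ ((k : ℝ) * (β : ℝ))
        ≤ ((k + 1 : ℕ) : ℝ) ^ (((k + 1 : ℕ) : ℝ) * (β : ℝ)) := by
      calc ((k + 1 : ℕ) : ℝ) * (k : ℝ) ^ ((k : ℝ) * (β : ℝ))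
          ≤ ((k + 1 : ℕ) : ℝ) ^ (β : ℝ) * ((k + 1 : ℕ) : ℝ) ^ ((k : ℝ) * (β : ℝ)) := by
            gcongr
            · exact Real.self_le_rpow_of_one_le hk1 hβ'
            · omega
        _ = _ := by
            rw [← Real.rpow_add (by positivity)]
            congr 1; push_cast; ring
    calc _ ≤ ((k + 1 : ℕ) : ℝ) * (C * (B ^ k * (k : ℝ) ^ ((k : ℝ) * (β : ℝ)))) := by
          gcongr; exact ih k
      _ = C * (B ^ k * (((k + 1 : ℕ) : ℝ) * (k : ℝ) ^ ((k : ℝ) * (β : ℝ)))) := by ring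
      _ ≤ _ := by
          gcongr
          omega

/-- The jet of `x^n f` vanishes below degree `n`, so `R^n ≤ R^k` on its support. The factor `R^k` is
absorbed in the geometric part of the Gevrey bound, against which `c` is still square summable. -/
lemma norm_jetMap_momentumOp_pow_mul_le (hβ : 1 ≤ β) (hc : IsGevreySummable β c)
    (f : gelfandShilov α β) {R : ℝ} (hR : 1 ≤ R) :
    ∃ M, ∀ n, ‖jetMap α hc ((momentumOp α β ^ n) f)‖ * R ^ n ≤ M := by
  obtain ⟨C, hC, B, hB, h⟩ := exists_norm_iteratedDeriv_zero_le f
  have hsum := hc (B * R) (by positivity)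
  set w : ℕ → ℝ := fun k => c k * ((B * R) ^ k * (k : ℝ) ^ ((k : ℝ) * (β : ℝ)))
  refine ⟨C * Real.sqrt (∑' k, w k ^ 2), fun n => ?_⟩
  have hterm : ∀ k, ‖jetMap α hc ((momentumOp α β ^ n) f) k‖ ^ 2 * (R ^ n) ^ 2
      ≤ C ^ 2 * w k ^ 2 := by
    intro k
    rw [← mul_pow, ← mul_pow, ← sq_abs (C * w k)]
    refine pow_le_pow_left₀ (by positivity) ?_ 2
    rw [jetMap_apply]
    rcases lt_or_ge k n with hk | hk
    · rw [iteratedDeriv_momentumOp_pow_of_lt f hk]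
      simp only [mul_zero, norm_zero, zero_mul]
      positivity
    · have hw : 0 ≤ (B * R) ^ k * (k : ℝ) ^ ((k : ℝ) * (β : ℝ)) := by positivity
      rw [norm_mul, Complex.norm_real, Real.norm_eq_abs, abs_mul, abs_of_pos hC, abs_mul,
        abs_of_nonneg hw]
      calc _ ≤ |c k| * (C * (B ^ k * (k : ℝ) ^ ((k : ℝ) * (β : ℝ)))) * R ^ k := by
            gcongr
            · exact norm_iteratedDeriv_momentumOp_pow_le hβ hC hB h n k
        _ = _ := by rw [mul_pow]; ring
  refine le_of_sq_le_sq ?_ (by positivity)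
  rw [mul_pow, mul_pow, Real.sq_sqrt (tsum_nonneg fun k => sq_nonneg _), ← tsum_mul_left]
  have h2 := lp.hasSum_norm (p := 2) (by norm_num) (jetMap α hc ((momentumOp α β ^ n) f))
  simp only [ENNReal.toReal_ofNat, Real.rpow_ofNat] at h2
  exact hasSum_le hterm (h2.mul_right _) (hsum.mul_left _).hasSum

lemma gelfandShilovToL2_momentumOp_symm (f g : gelfandShilov α β) :
    inner ℂ (gelfandShilovToL2 α β (momentumOp α β f)) (gelfandShilovToL2 α β g)
      = inner ℂ (gelfandShilovToL2 α β f) (gelfandShilovToL2 α β (momentumOp α β g)) := by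
  rw [inner_gelfandShilovToL2, inner_gelfandShilovToL2]
  refine integral_congr_ae (Eventually.of_forall fun x => ?_)
  change conj ((x : ℂ) * f.1 x) * g.1 x = conj (f.1 x) * (x * g.1 x)
  rw [map_mul, Complex.conj_ofReal]; ring

/-- Symmetry on `W` minus symmetry in `L²` is symmetry on jets. With Cauchy-Schwarz it makes the
norms of the jets of `x^n g` log-convex, while they decay superexponentially. -/
lemma apply_zero_eq_zero_of_isSchrodingerInvariant (hβ : 1 ≤ β) (hc : IsGevreySummable β c)
    (hc0 : ∀ k, c k ≠ 0) {W : Submodule ℂ KreinL2}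
    (hW : IsSchrodingerInvariant (kreinForm _ _) (kreinEmbedding α hc) W) {g : gelfandShilov α β}
    (hg : kreinEmbedding α hc g ∈ W) : g.1 0 = 0 := by
  have hmem : ∀ n, kreinEmbedding α hc ((momentumOp α β ^ n) g) ∈ W := by
    intro n
    induction n with
    | zero => exact hg
    | succ n ih =>
      rw [pow_succ', Module.End.mul_apply]
      exact hW.momentum_mem _ ih
  have hsymm : ∀ n m, inner ℂ (jetMap α hc ((momentumOp α β ^ (n + 1)) g))
      (jetMap α hc ((momentumOp α β ^ m) g)) = inner ℂ (jetMap α hc ((momentumOp α β ^ n) g))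
      (jetMap α hc ((momentumOp α β ^ (m + 1)) g)) := by
    intro n m
    have h := hW.momentum_symm _ _ (hmem n) (hmem m)
    simp only [kreinForm_apply, kreinEmbedding_fst, kreinEmbedding_snd] at h
    rw [gelfandShilovToL2_momentumOp_symm, sub_right_inj] at h
    rw [pow_succ', Module.End.mul_apply, pow_succ', Module.End.mul_apply]
    exact h
  have h1 := eq_zero_of_log_convex_of_superexponential_decay
    (s := fun n => ‖jetMap α hc ((momentumOp α β ^ n) g)‖) (fun n => norm_nonneg _)
    (fun n => by
      have h1 := norm_inner_le_norm (𝕜 := ℂ) (jetMap α hc ((momentumOp α β ^ n) g))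
        (jetMap α hc ((momentumOp α β ^ (n + 2)) g))
      rwa [← hsymm n (n + 1), inner_self_eq_norm_sq_to_K, norm_pow, RCLike.norm_ofReal,
        abs_of_nonneg (norm_nonneg _)] at h1)
    (fun R hR => norm_jetMap_momentumOp_pow_mul_le hβ hc g hR)
  rw [norm_eq_zero, jetMap_eq_zero_iff hc hc0, mem_flatGelfandShilov] at h1
  -- The first derivative of `x g` at `0` is `g 0`.
  have h2 := h1 1
  rw [iteratedDeriv_momentumOp_pow_self] at h2
  simpa using h2

/-- Every invariant subspace is contained in the positive component. -/
lemma le_kreinPos_of_isSchrodingerInvariant (hβ : 1 ≤ β) (hc : IsGevreySummable β c)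
    (hc0 : ∀ k, c k ≠ 0) {W : Submodule ℂ KreinL2}
    (hW : IsSchrodingerInvariant (kreinForm _ _) (kreinEmbedding α hc) W) :
    W ≤ kreinPos _ _ := by
  -- The induction runs over all `f` at once: the position operator keeps `f` in `W` and lowers the
  -- order of the derivative by one.
  have hflat : ∀ k, ∀ f : gelfandShilov α β, kreinEmbedding α hc f ∈ W →
      iteratedDeriv k f.1 0 = 0 := by
    intro k
    induction k with
    | zero =>
      intro f hf
      rw [iteratedDeriv_zero]
      exact apply_zero_eq_zero_of_isSchrodingerInvariant hβ hc hc0 hW hf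
    | succ k ih =>
      intro f hf
      have := ih _ (hW.position_mem f hf)
      rw [iteratedDeriv_positionOp] at this
      exact (mul_eq_zero.1 this).resolve_left Complex.I_ne_zero
  intro x hx
  refine closure_minimal ?_ isClosed_kreinPos (hW.dense hx)
  rintro _ ⟨hf, f, rfl⟩
  exact (jetMap_eq_zero_iff hc hc0 f).2 fun k => hflat k f hf

end Invariant

/-! ## Multiplication by the variable in `L²` -/

/-- The domain of the operator of multiplication by the variable. -/
def mulDomain : Submodule ℂ (Lp ℂ 2 (volume : Measure ℝ)) where
  carrier := {u | MemLp (fun x : ℝ => (x : ℂ) * u x) 2 volume}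
  zero_mem' := by
    refine (MemLp.zero : MemLp (0 : ℝ → ℂ) 2 volume).ae_eq ?_
    filter_upwards [Lp.coeFn_zero ℂ 2 (volume : Measure ℝ)] with x hx
    change (0 : ℂ) = x * (0 : Lp ℂ 2 (volume : Measure ℝ)) x
    rw [hx, Pi.zero_apply, mul_zero]
  add_mem' {u v} hu hv := by
    refine (MemLp.add hu hv).ae_eq ?_
    filter_upwards [Lp.coeFn_add u v] with x hx
    change (x : ℂ) * u x + (x : ℂ) * v x = x * (u + v : Lp ℂ 2 volume) x
    rw [hx, Pi.add_apply, mul_add]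
  smul_mem' a u hu := by
    refine (MemLp.const_smul hu a).ae_eq ?_
    filter_upwards [Lp.coeFn_smul a u] with x hx
    change a * ((x : ℂ) * u x) = x * (a • u : Lp ℂ 2 volume) x
    rw [hx, Pi.smul_apply, smul_eq_mul, mul_left_comm]

/-- Multiplication by the variable. -/
noncomputable def mulOp : mulDomain →ₗ[ℂ] Lp ℂ 2 (volume : Measure ℝ) where
  toFun u := MemLp.toLp _ u.2
  map_add' u v := by
    refine Lp.ext ?_
    filter_upwards [MemLp.coeFn_toLp (u + v).2, MemLp.coeFn_toLp u.2, MemLp.coeFn_toLp v.2,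
      Lp.coeFn_add (MemLp.toLp _ u.2) (MemLp.toLp _ v.2), Lp.coeFn_add u.1 v.1]
      with x h1 h2 h3 h4 h5
    rw [h1, h4, Pi.add_apply, h2, h3, Submodule.coe_add, h5, Pi.add_apply, mul_add]
  map_smul' a u := by
    refine Lp.ext ?_
    filter_upwards [MemLp.coeFn_toLp (a • u).2, MemLp.coeFn_toLp u.2,
      Lp.coeFn_smul a (MemLp.toLp _ u.2), Lp.coeFn_smul a u.1]
      with x h1 h2 h3 h4
    rw [h1, RingHom.id_apply, h3, Pi.smul_apply, h2, Submodule.coe_smul, h4, Pi.smul_apply,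
      smul_eq_mul, smul_eq_mul, mul_left_comm]

lemma coeFn_mulOp (u : mulDomain) : mulOp u =ᵐ[volume] fun x : ℝ => (x : ℂ) * u.1 x :=
  MemLp.coeFn_toLp u.2

lemma inner_mulOp_left (u v : mulDomain) :
    inner ℂ (mulOp u) v.1 = inner ℂ u.1 (mulOp v) := by
  rw [L2.inner_def, L2.inner_def]
  refine integral_congr_ae ?_
  filter_upwards [coeFn_mulOp u, coeFn_mulOp v] with x hu hv
  rw [hu, hv, RCLike.inner_apply, RCLike.inner_apply, map_mul, Complex.conj_ofReal]
  ring

/-- The real multiples of the operator of multiplication by the variable are selfadjoint. -/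
lemma exists_smul_mulOp_eq_iff {r : ℝ} (hr : r ≠ 0) (y z : Lp ℂ 2 (volume : Measure ℝ)) :
    (∃ hy : y ∈ mulDomain, (r : ℂ) • mulOp ⟨y, hy⟩ = z) ↔
      ∀ u : mulDomain, inner ℂ ((r : ℂ) • mulOp u) y = inner ℂ u.1 z := by
  constructor
  · rintro ⟨hy, rfl⟩ u
    rw [inner_smul_left, inner_smul_right, Complex.conj_ofReal, inner_mulOp_left u ⟨y, hy⟩]
  intro h
  -- `v` is the defect to be shown zero. Its truncations to `[-n, n]` are in `L²` and in the domain,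
  -- since `x` is bounded there; testing the adjoint relation on them gives `∫_{[-n,n]} |v|² = 0`.
  let v : ℝ → ℂ := fun x => (r : ℂ) * (x * y x) - z x
  have hloc : ∀ n : ℕ, ∀ᵐ x : ℝ, x ∈ Set.Icc (-n : ℝ) n → v x = 0 := by
    intro n
    have hbd : ∀ w : ℝ → ℂ, MemLp w 2 volume →
        MemLp ((Set.Icc (-n : ℝ) n).indicator fun x => (x : ℂ) * w x) 2 volume := by
      intro w hw
      refine MemLp.of_le_mul (c := n) hw ?_ (Eventually.of_forall fun x => ?_)
      · exact (Complex.continuous_ofReal.aestronglyMeasurable.mul hw.1).indicator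
          measurableSet_Icc
      · by_cases hx : x ∈ Set.Icc (-n : ℝ) n
        · rw [Set.indicator_of_mem hx, norm_mul, Complex.norm_real, Real.norm_eq_abs]
          gcongr
          exact abs_le.2 hx
        · rw [Set.indicator_of_notMem hx, norm_zero]; positivity
    have hw : MemLp ((Set.Icc (-n : ℝ) n).indicator v) 2 volume := by
      refine (((hbd y (Lp.memLp y)).const_smul (r : ℂ)).sub
        ((Lp.memLp z).indicator (measurableSet_Icc (a := (-n : ℝ)) (b := n)))).ae_eq
        (Eventually.of_forall fun x => ?_)
      by_cases hx : x ∈ Set.Icc (-n : ℝ) n <;> simp [hx, v]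
    have hwd : hw.toLp _ ∈ mulDomain := by
      refine (hbd _ hw).ae_eq ?_
      filter_upwards [hw.coeFn_toLp] with x hx
      rw [hx]
      by_cases hx : x ∈ Set.Icc (-n : ℝ) n <;> simp [hx]
    have h1 := h ⟨_, hwd⟩
    rw [inner_smul_left, Complex.conj_ofReal, L2.inner_def, L2.inner_def, ← integral_const_mul,
      ← sub_eq_zero, ← integral_sub ((L2.integrable_inner _ _).const_mul _)
      (L2.integrable_inner _ _)] at h1
    have h2 : inner ℂ (hw.toLp _) (hw.toLp _) = (0 : ℂ) := by
      rw [← h1, L2.inner_def]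
      refine integral_congr_ae ?_
      filter_upwards [hw.coeFn_toLp, coeFn_mulOp ⟨_, hwd⟩] with x hx hx'
      rw [hx', hx, RCLike.inner_apply, RCLike.inner_apply, RCLike.inner_apply, map_mul,
        Complex.conj_ofReal]
      by_cases hxn : x ∈ Set.Icc (-n : ℝ) n
      · simp only [Set.indicator_of_mem hxn, v]; ring
      · simp [hxn]
    rw [inner_self_eq_zero, Lp.eq_zero_iff_ae_eq_zero] at h2
    filter_upwards [h2, hw.coeFn_toLp] with x hx hx' hxn
    rw [hx, Set.indicator_of_mem hxn] at hx'
    exact hx'.symm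
  have hall : ∀ᵐ x : ℝ, (r : ℂ) * (x * y x) = z x := by
    filter_upwards [ae_all_iff.2 hloc] with x hx
    obtain ⟨n, hn⟩ := exists_nat_ge |x|
    exact sub_eq_zero.1 (hx n (abs_le.1 hn))
  have hr' : (r : ℂ) ≠ 0 := Complex.ofReal_ne_zero.2 hr
  have hy : y ∈ mulDomain := by
    refine ((Lp.memLp z).const_smul (r : ℂ)⁻¹).ae_eq ?_
    filter_upwards [hall] with x hx
    rw [Pi.smul_apply, ← hx, smul_eq_mul, inv_mul_cancel_left₀ hr']
  refine ⟨hy, Lp.ext ?_⟩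
  filter_upwards [hall, coeFn_mulOp ⟨y, hy⟩, Lp.coeFn_smul (r : ℂ) (mulOp ⟨y, hy⟩)]
    with x h1 h2 h3
  rw [h3, Pi.smul_apply, h2, smul_eq_mul, h1]

/-! ## Selfadjoint operators in the positive component -/

/-- The embedding of `L²` as the positive component of the Krein space. -/
noncomputable def kreinInl : Lp ℂ 2 (volume : Measure ℝ) →L[ℂ] KreinL2 :=
  (WithLp.prodContinuousLinearEquiv 2 ℂ _ _).symm.toContinuousLinearMap.comp
    (ContinuousLinearMap.inl ℂ _ _)

@[simp] lemma kreinInl_fst (u : Lp ℂ 2 (volume : Measure ℝ)) : (kreinInl u).fst = u := rfl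

@[simp] lemma kreinInl_snd (u : Lp ℂ 2 (volume : Measure ℝ)) : (kreinInl u).snd = 0 := rfl

lemma kreinInl_mem (u : Lp ℂ 2 (volume : Measure ℝ)) : kreinInl u ∈ kreinPos _ _ := rfl

lemma kreinForm_kreinInl (u v : Lp ℂ 2 (volume : Measure ℝ)) :
    kreinForm _ _ (kreinInl u) (kreinInl v) = inner ℂ u v := by
  simp [kreinForm_apply]

/-- The operator in the positive component that a unitary operator `T` on `L²` transforms to
multiplication by `r x`. -/
noncomputable def kreinMulOp (T : Lp ℂ 2 (volume : Measure ℝ) ≃ₗᵢ[ℂ] Lp ℂ 2 (volume : Measure ℝ))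
    (r : ℝ) : KreinL2 →ₗ.[ℂ] KreinL2 where
  domain := kreinPos _ _ ⊓
    mulDomain.comap (T.toLinearEquiv.toLinearMap ∘ₗ (WithLp.fstL 2 ℂ _ _).toLinearMap)
  toFun := kreinInl.toLinearMap ∘ₗ T.symm.toLinearEquiv.toLinearMap ∘ₗ ((r : ℂ) • mulOp) ∘ₗ
    ((T.toLinearEquiv.toLinearMap ∘ₗ (WithLp.fstL 2 ℂ _ _).toLinearMap).restrict
      fun _ hx => hx.2)

section KreinMulOp

variable {T : Lp ℂ 2 (volume : Measure ℝ) ≃ₗᵢ[ℂ] Lp ℂ 2 (volume : Measure ℝ)} {r : ℝ}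

lemma mem_graph_kreinMulOp_iff {x y : KreinL2} :
    (x, y) ∈ (kreinMulOp T r).graph ↔ x ∈ kreinPos _ _ ∧ y ∈ kreinPos _ _ ∧
      ∃ h : T x.fst ∈ mulDomain, (r : ℂ) • mulOp ⟨T x.fst, h⟩ = T y.fst := by
  rw [LinearPMap.mem_graph_iff]
  constructor
  · rintro ⟨⟨x', hx'⟩, rfl, rfl⟩
    refine ⟨hx'.1, rfl, hx'.2, ?_⟩
    exact (T.apply_symm_apply _).symm
  · rintro ⟨hx, hy, h, heq⟩
    refine ⟨⟨x, hx, h⟩, rfl, withLp_prod_ext ?_ (Eq.symm hy)⟩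
    change T.symm ((r : ℂ) • mulOp ⟨T x.fst, h⟩) = y.fst
    rw [heq, T.symm_apply_apply]

lemma isSelfAdjointOperatorOn_kreinMulOp (hr : r ≠ 0)
    (hd : ((kreinPos _ _ : Submodule ℂ KreinL2) : Set KreinL2) ⊆ closure (kreinMulOp T r).domain) :
    IsSelfAdjointOperatorOn (kreinForm _ _) (kreinPos _ _) (kreinMulOp T r) := by
  refine ⟨inf_le_left, hd, fun x => rfl, fun y hy z hz => ?_⟩
  rw [mem_graph_kreinMulOp_iff, exists_smul_mulOp_eq_iff hr]
  have hform : ∀ x : (kreinMulOp T r).domain, kreinForm _ _ (kreinMulOp T r x) y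
      = inner ℂ ((r : ℂ) • mulOp ⟨T x.1.fst, x.2.2⟩) (T y.fst) := by
    intro x
    have h1 : (kreinMulOp T r x).fst = T.symm ((r : ℂ) • mulOp ⟨T x.1.fst, x.2.2⟩) := rfl
    have h2 : (kreinMulOp T r x).snd = 0 := rfl
    rw [kreinForm_apply, h1, h2, inner_zero_left, sub_zero, ← T.inner_map_map, T.apply_symm_apply]
  constructor
  · rintro ⟨-, -, h⟩ x
    rw [hform, h, kreinForm_apply, mem_kreinPos.1 hz, inner_zero_right, sub_zero,
      T.inner_map_map]
  · refine fun h => ⟨hy, hz, fun u => ?_⟩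
    have hu : kreinInl (T.symm u) ∈ (kreinMulOp T r).domain :=
      ⟨rfl, by
        change T (T.symm u) ∈ mulDomain
        rw [T.apply_symm_apply]; exact u.2⟩
    have h1 := h ⟨_, hu⟩
    rw [hform] at h1
    have h2 : (⟨T (kreinInl (T.symm u)).fst, hu.2⟩ : mulDomain) = u :=
      Subtype.ext (T.apply_symm_apply u)
    refine ((congrArg (fun v => inner ℂ ((r : ℂ) • mulOp v) (T y.fst)) h2).symm.trans h1).trans ?_
    rw [kreinForm_apply, kreinInl_snd, inner_zero_left, sub_zero, kreinInl_fst,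
      ← T.inner_map_map, T.apply_symm_apply]

end KreinMulOp

-- Momentum and position on flat test functions

section Schrodinger

variable {α : ℝ≥0∞} {β : ℝ≥0} {c : ℕ → ℝ}

lemma kreinEmbedding_mem_kreinPos_iff (hc : IsGevreySummable β c) (hc0 : ∀ k, c k ≠ 0)
    {f : gelfandShilov α β} :
    kreinEmbedding α hc f ∈ kreinPos _ _ ↔ f ∈ flatGelfandShilov α β :=
  jetMap_eq_zero_iff hc hc0 f

lemma momentumOp_mem_flat {f : gelfandShilov α β} (hf : f ∈ flatGelfandShilov α β) :
    momentumOp α β f ∈ flatGelfandShilov α β := fun k => by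
  rw [iteratedDeriv_momentumOp, hf, mul_zero]

lemma positionOp_mem_flat {f : gelfandShilov α β} (hf : f ∈ flatGelfandShilov α β) :
    positionOp α β f ∈ flatGelfandShilov α β := fun k => by
  rw [iteratedDeriv_positionOp, hf, mul_zero]

lemma exists_mulOp_gelfandShilovToL2 (f : gelfandShilov α β) :
    ∃ h : gelfandShilovToL2 α β f ∈ mulDomain,
      mulOp ⟨_, h⟩ = gelfandShilovToL2 α β (momentumOp α β f) := by
  have hae : gelfandShilovToL2 α β (momentumOp α β f) =ᵐ[volume]
      fun x : ℝ => (x : ℂ) * gelfandShilovToL2 α β f x := by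
    filter_upwards [coeFn_gelfandShilovToL2 f, coeFn_gelfandShilovToL2 (momentumOp α β f)]
      with x h1 h2
    rw [h1, h2]; rfl
  have h : gelfandShilovToL2 α β f ∈ mulDomain := (Lp.memLp _).ae_eq hae
  exact ⟨h, Lp.ext ((coeFn_mulOp ⟨_, h⟩).trans hae.symm)⟩

/-- The transform of `f'` is `2πi x` times that of `f`, and `i · 2πi = -2π`. -/
lemma fourier_positionOp_apply (f : gelfandShilov α β) (x : ℝ) :
    (𝓕 (gelfandShilovToSchwartz α β (positionOp α β f))) x
      = ((-2 * Real.pi : ℝ) : ℂ) * (x * (𝓕 (gelfandShilovToSchwartz α β f)) x) := by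
  have h1 : gelfandShilovToSchwartz α β (positionOp α β f)
      = Complex.I • SchwartzMap.derivCLM ℂ ℂ (gelfandShilovToSchwartz α β f) := by
    ext y; rfl
  have h2 := congrFun (Real.fourier_deriv (gelfandShilovToSchwartz α β f).integrable
    (gelfandShilovToSchwartz α β f).differentiable
    (SchwartzMap.derivCLM ℂ ℂ (gelfandShilovToSchwartz α β f)).integrable) x
  have h3 : (𝓕 (SchwartzMap.derivCLM ℂ ℂ (gelfandShilovToSchwartz α β f))) x
      = 𝓕 (deriv (gelfandShilovToSchwartz α β f)) x := rfl
  rw [h1, FourierTransform.fourier_smul, smul_apply, h3, h2, SchwartzMap.fourier_coe]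
  simp only [smul_eq_mul]
  push_cast
  linear_combination (2 * Real.pi * x * (𝓕 ⇑(gelfandShilovToSchwartz α β f)) x) * Complex.I_sq

lemma exists_mulOp_fourier_gelfandShilovToL2 (f : gelfandShilov α β) :
    ∃ h : Lp.fourierTransformₗᵢ ℝ ℂ (gelfandShilovToL2 α β f) ∈ mulDomain,
      ((-2 * Real.pi : ℝ) : ℂ) • mulOp ⟨_, h⟩
        = Lp.fourierTransformₗᵢ ℝ ℂ (gelfandShilovToL2 α β (positionOp α β f)) := by
  have hF : ∀ g : gelfandShilov α β, Lp.fourierTransformₗᵢ ℝ ℂ (gelfandShilovToL2 α β g)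
      =ᵐ[volume] ⇑(𝓕 (gelfandShilovToSchwartz α β g) : SchwartzMap ℝ ℂ) := fun g => by
    have h1 : Lp.fourierTransformₗᵢ ℝ ℂ (gelfandShilovToL2 α β g)
        = (𝓕 (gelfandShilovToSchwartz α β g)).toLp 2 := SchwartzMap.toLp_fourier_eq _
    rw [h1]
    exact SchwartzMap.coeFn_toLp _ 2 volume
  have hr : ((-2 * Real.pi : ℝ) : ℂ) ≠ 0 :=
    Complex.ofReal_ne_zero.2 (mul_ne_zero (by norm_num) Real.pi_ne_zero)
  have hae : Lp.fourierTransformₗᵢ ℝ ℂ (gelfandShilovToL2 α β (positionOp α β f)) =ᵐ[volume]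
      fun x : ℝ => ((-2 * Real.pi : ℝ) : ℂ) *
        ((x : ℂ) * Lp.fourierTransformₗᵢ ℝ ℂ (gelfandShilovToL2 α β f) x) := by
    filter_upwards [hF f, hF (positionOp α β f)] with x h1 h2
    rw [h1, h2, fourier_positionOp_apply]
  have h : Lp.fourierTransformₗᵢ ℝ ℂ (gelfandShilovToL2 α β f) ∈ mulDomain := by
    refine ((Lp.memLp (Lp.fourierTransformₗᵢ ℝ ℂ
      (gelfandShilovToL2 α β (positionOp α β f)))).const_smul
        ((-2 * Real.pi : ℝ) : ℂ)⁻¹).ae_eq ?_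
    filter_upwards [hae] with x hx
    rw [Pi.smul_apply, hx, smul_eq_mul, inv_mul_cancel_left₀ hr]
  refine ⟨h, Lp.ext ?_⟩
  filter_upwards [hae, coeFn_mulOp ⟨_, h⟩,
    Lp.coeFn_smul ((-2 * Real.pi : ℝ) : ℂ) (mulOp ⟨_, h⟩)] with x h1 h2 h3
  rw [h3, h1, Pi.smul_apply, h2, smul_eq_mul]

/-- The momentum operator in the positive component. -/
noncomputable def kreinMomentum : KreinL2 →ₗ.[ℂ] KreinL2 :=
  kreinMulOp (LinearIsometryEquiv.refl ℂ _) 1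

/-- The position operator in the positive component. -/
noncomputable def kreinPosition : KreinL2 →ₗ.[ℂ] KreinL2 :=
  kreinMulOp (Lp.fourierTransformₗᵢ ℝ ℂ) (-2 * Real.pi)

lemma mem_graph_kreinMomentum (hc : IsGevreySummable β c) (hc0 : ∀ k, c k ≠ 0)
    {f : gelfandShilov α β} (hf : kreinEmbedding α hc f ∈ kreinPos _ _) :
    (kreinEmbedding α hc f, kreinEmbedding α hc (momentumOp α β f)) ∈ kreinMomentum.graph := by
  obtain ⟨h, heq⟩ := exists_mulOp_gelfandShilovToL2 f
  refine mem_graph_kreinMulOp_iff.2 ⟨hf, (kreinEmbedding_mem_kreinPos_iff hc hc0).2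
    (momentumOp_mem_flat ((kreinEmbedding_mem_kreinPos_iff hc hc0).1 hf)), h, ?_⟩
  rw [Complex.ofReal_one, one_smul]
  exact heq

lemma mem_graph_kreinPosition (hc : IsGevreySummable β c) (hc0 : ∀ k, c k ≠ 0)
    {f : gelfandShilov α β} (hf : kreinEmbedding α hc f ∈ kreinPos _ _) :
    (kreinEmbedding α hc f, kreinEmbedding α hc (positionOp α β f)) ∈ kreinPosition.graph :=
  mem_graph_kreinMulOp_iff.2 ⟨hf, (kreinEmbedding_mem_kreinPos_iff hc hc0).2
    (positionOp_mem_flat ((kreinEmbedding_mem_kreinPos_iff hc hc0).1 hf)),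
    exists_mulOp_fourier_gelfandShilovToL2 f⟩

lemma kreinEmbedding_eq_kreinInl (hc : IsGevreySummable β c) (hc0 : ∀ k, c k ≠ 0)
    {f : gelfandShilov α β} (hf : f ∈ flatGelfandShilov α β) :
    kreinEmbedding α hc f = kreinInl (gelfandShilovToL2 α β f) :=
  withLp_prod_ext rfl ((jetMap_eq_zero_iff hc hc0 f).2 hf)

lemma kreinPos_subset_closure_kreinInl {S : Set (Lp ℂ 2 (volume : Measure ℝ))} (hS : Dense S) :
    ((kreinPos _ _ : Submodule ℂ KreinL2) : Set KreinL2) ⊆ closure (kreinInl '' S) := by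
  intro x hx
  have h1 : x = kreinInl x.fst := withLp_prod_ext rfl hx
  rw [h1]
  exact image_closure_subset_closure_image kreinInl.continuous ⟨_, hS _, rfl⟩

lemma kreinPos_subset_closure_kreinEmbedding (hβ : 1 < β) (hc : IsGevreySummable β c)
    (hc0 : ∀ k, c k ≠ 0) : ((kreinPos _ _ : Submodule ℂ KreinL2) : Set KreinL2) ⊆
      closure {x | x ∈ kreinPos _ _ ∧ ∃ f : gelfandShilov α β, kreinEmbedding α hc f = x} := by
  refine (kreinPos_subset_closure_kreinInl (dense_image_flatGelfandShilov α hβ)).trans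
    (closure_mono ?_)
  rintro _ ⟨_, ⟨f, hf, rfl⟩, rfl⟩
  exact ⟨kreinInl_mem _, f, kreinEmbedding_eq_kreinInl hc hc0 hf⟩

lemma isSelfAdjointOperatorOn_kreinMomentum (hβ : 1 < β) (hc : IsGevreySummable β c)
    (hc0 : ∀ k, c k ≠ 0) :
    IsSelfAdjointOperatorOn (kreinForm _ _) (kreinPos _ _) kreinMomentum := by
  refine isSelfAdjointOperatorOn_kreinMulOp one_ne_zero
    -- The operator does not depend on `α`, so test functions of any lower index may be used to show
    -- that its domain is dense.
    ((kreinPos_subset_closure_kreinEmbedding (α := 0) hβ hc hc0).trans (closure_mono ?_))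
  rintro _ ⟨hf, f, rfl⟩
  exact LinearPMap.mem_domain_of_mem_graph (mem_graph_kreinMomentum hc hc0 hf)

lemma isSelfAdjointOperatorOn_kreinPosition (hβ : 1 < β) (hc : IsGevreySummable β c)
    (hc0 : ∀ k, c k ≠ 0) :
    IsSelfAdjointOperatorOn (kreinForm _ _) (kreinPos _ _) kreinPosition := by
  refine isSelfAdjointOperatorOn_kreinMulOp (mul_ne_zero (by norm_num) Real.pi_ne_zero)
    ((kreinPos_subset_closure_kreinEmbedding (α := 0) hβ hc hc0).trans (closure_mono ?_))
  rintro _ ⟨hf, f, rfl⟩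
  exact LinearPMap.mem_domain_of_mem_graph (mem_graph_kreinPosition hc hc0 hf)

/-- Yields the symmetry of both operators on the test functions in `H`; for position it replaces an
integration by parts. -/
lemma IsSelfAdjointOperatorOn.symm {K : Type*} [NormedAddCommGroup K] [NormedSpace ℂ K]
    {B : K →ₗ⋆[ℂ] K →ₗ[ℂ] ℂ} {W : Submodule ℂ K} {A : K →ₗ.[ℂ] K}
    (hA : IsSelfAdjointOperatorOn B W A) {x x' y y' : K} (hx : (x, x') ∈ A.graph)
    (hy : (y, y') ∈ A.graph) : B x' y = B x y' := by
  have hyW : y ∈ W := hA.1 (LinearPMap.mem_domain_of_mem_graph hy)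
  have hy'W : y' ∈ W := by
    obtain ⟨z, -, hz⟩ := A.mem_graph_iff.1 hy
    exact (congrArg (· ∈ W) hz).mp (hA.2.2.1 z)
  obtain ⟨z, rfl, rfl⟩ := A.mem_graph_iff.1 hx
  exact (hA.2.2.2 y hyW y' hy'W).1 hy z

lemma isSchrodingerInvariant_kreinPos (hβ : 1 < β) (hc : IsGevreySummable β c)
    (hc0 : ∀ k, c k ≠ 0) :
    IsSchrodingerInvariant (kreinForm _ _) (kreinEmbedding α hc) (kreinPos _ _) where
  dense := kreinPos_subset_closure_kreinEmbedding hβ hc hc0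
  momentum_mem _ hf := (kreinEmbedding_mem_kreinPos_iff hc hc0).2
    (momentumOp_mem_flat ((kreinEmbedding_mem_kreinPos_iff hc hc0).1 hf))
  position_mem _ hf := (kreinEmbedding_mem_kreinPos_iff hc hc0).2
    (positionOp_mem_flat ((kreinEmbedding_mem_kreinPos_iff hc hc0).1 hf))
  momentum_symm _ _ hf hg := (isSelfAdjointOperatorOn_kreinMomentum hβ hc hc0).symm
    (mem_graph_kreinMomentum hc hc0 hf) (mem_graph_kreinMomentum hc hc0 hg)
  position_symm _ _ hf hg := (isSelfAdjointOperatorOn_kreinPosition hβ hc hc0).symm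
    (mem_graph_kreinPosition hc hc0 hf) (mem_graph_kreinPosition hc hc0 hg)

/-! ## Vanishing moments -/

/-- Differentiating under the integral, the `k`-th derivative of `𝓕 G` at `0` is `(-2πi)^k` times
the `k`-th moment of `G`. -/
lemma toLp_mem_lTwoZero_iff (G : SchwartzMap ℝ ℂ) :
    G.toLp 2 volume ∈ lTwoZero ↔ ∀ k, iteratedDeriv k ⇑(𝓕 G : SchwartzMap ℝ ℂ) 0 = 0 := by
  have hint : ∀ k : ℕ, Integrable (fun x : ℝ => (x : ℂ) ^ k * G x) := fun k => by
    have h := G.integrable_pow_mul (volume : Measure ℝ) k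
    refine h.mono'
      ((Complex.continuous_ofReal.pow k).mul G.continuous).aestronglyMeasurable
      (Eventually.of_forall fun x => le_of_eq ?_)
    rw [norm_mul, norm_pow, Complex.norm_real]
  have hder : ∀ k : ℕ, iteratedDeriv k ⇑(𝓕 G : SchwartzMap ℝ ℂ) 0
      = (-2 * Real.pi * Complex.I) ^ k * ∫ x : ℝ, (x : ℂ) ^ k * G x := by
    intro k
    rw [SchwartzMap.fourier_coe, Real.iteratedDeriv_fourier (N := ⊤) (fun n _ => ?_) le_top,
      Real.fourier_eq, ← integral_const_mul]
    · refine integral_congr_ae (Eventually.of_forall fun x => ?_)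
      simp only [inner_zero_right, neg_zero, AddChar.map_zero_eq_one, one_smul,
        smul_eq_mul]
      ring
    · simpa using hint n
  have hae : ∀ k : ℕ, (fun x : ℝ => (x : ℂ) ^ k * G.toLp 2 volume x)
      =ᵐ[volume] fun x : ℝ => (x : ℂ) ^ k * G x := fun k => by
    filter_upwards [SchwartzMap.coeFn_toLp G 2 volume] with x hx
    rw [hx]
  refine forall_congr' fun k => ?_
  rw [integrable_congr (hae k), integral_congr_ae (hae k), hder, mul_eq_zero,
    and_iff_right (hint k), or_iff_right (pow_ne_zero _ ?_)]
  simp [Real.pi_ne_zero]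

/-- The Fourier transform is injective on `L²`, so the only candidate preimage is the inverse
transform of `f`, a Schwartz function whose moments are, up to nonzero factors, the derivatives of
`f` at `0`. -/
lemma gelfandShilovToL2_mem_fourierLTwoZero_iff {f : gelfandShilov α β} :
    gelfandShilovToL2 α β f ∈ fourierLTwoZero ↔ f ∈ flatGelfandShilov α β := by
  set F := gelfandShilovToSchwartz α β f
  have h1 : 𝓕 ((𝓕⁻ F).toLp 2) = gelfandShilovToL2 α β f := by
    rw [SchwartzMap.toLp_fourier_eq, FourierTransform.fourier_fourierInv_eq]
    rfl
  have h2 : gelfandShilovToL2 α β f ∈ fourierLTwoZero ↔ (𝓕⁻ F).toLp 2 ∈ lTwoZero := by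
    rw [← h1]
    exact (Lp.fourierTransformₗᵢ ℝ ℂ).injective.mem_set_image
  rw [h2, toLp_mem_lTwoZero_iff, FourierTransform.fourier_fourierInv_eq]
  rfl

lemma eq_gelfandShilovToL2_of_ae_eq {f : gelfandShilov α β} {u : Lp ℂ 2 (volume : Measure ℝ)}
    (h : u =ᵐ[volume] (f : ℝ → ℂ)) : u = gelfandShilovToL2 α β f :=
  Lp.ext (h.trans (coeFn_gelfandShilovToL2 f).symm)

lemma dense_fourierLTwoZero : Dense fourierLTwoZero := by
  refine (dense_image_flatGelfandShilov 0 one_lt_two).mono ?_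
  rintro _ ⟨f, hf, rfl⟩
  exact gelfandShilovToL2_mem_fourierLTwoZero_iff.2 hf

end Schrodinger

-- The main theorem

theorem mainTheorem1 (α : ℝ≥0∞) (β : ℝ≥0) (hβ : 1 < β) (δ : ℝ) (hδ : (β : ℝ) < δ)
    (J : ℂ → ℂ) (hJ : IsInfraExponential J (1 / (2 * δ)))
    (c : ℕ → ℝ) (hc : ∀ k, c k ≠ 0)
    (hJc : ∀ k : ℕ, iteratedDeriv k J 0 / (k ! : ℂ) = ((c k ^ 2 : ℝ) : ℂ)) :
    (∀ f g : gelfandShilov α β, IndefProdConverges c f g) ∧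
    ∃ (K : Type) (_ : NormedAddCommGroup K) (_ : InnerProductSpace ℂ K) (_ : CompleteSpace K)
      (B : K →ₗ⋆[ℂ] K →ₗ[ℂ] ℂ) (ι : gelfandShilov α β →ₗ[ℂ] K),
      IsMaximalKreinCompletion (fun f g : gelfandShilov α β => indefProd c f g) B ι ∧
      HasCountablyInfiniteNegativityRank B ∧
      ∃ H : Submodule ℂ K,
        -- `H` is closed, maximal positive definite, and the largest positive definite subspace
        -- that is invariant under the Schrödinger representation
        IsClosed (H : Set K) ∧ Maximal (IsPosDefOn B) H ∧
        IsGreatest {W : Submodule ℂ K | IsPosDefOn B W ∧ IsSchrodingerInvariant B ι W} H ∧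
        -- momentum and position extend to selfadjoint operators in `H`
        (∃ P Q : K →ₗ.[ℂ] K, IsSelfAdjointOperatorOn B H P ∧ IsSelfAdjointOperatorOn B H Q ∧
          ∀ f, ι f ∈ H →
            (ι f, ι (momentumOp α β f)) ∈ P.graph ∧ (ι f, ι (positionOp α β f)) ∈ Q.graph) ∧
        -- the test functions in `H` are those in the Fourier transform of `L²_0`
        (∀ f : gelfandShilov α β, ι f ∈ H ↔ ∃ u ∈ fourierLTwoZero, u =ᵐ[volume] (f : ℝ → ℂ)) ∧
        -- and `H` is the closure of the Fourier transform of `L²_0`, embedded isometrically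
        -- into `K` by the continuous map that agrees with `ι` on test functions
        ∃ j : Lp ℂ 2 (volume : Measure ℝ) →L[ℂ] K,
          (∀ u v, B (j u) (j v) = inner ℂ u v) ∧
          (∀ f : gelfandShilov α β, ∀ u ∈ fourierLTwoZero, u =ᵐ[volume] (f : ℝ → ℂ) →
            j u = ι f) ∧
          (H : Set K) = closure (j '' fourierLTwoZero) := by
  have hcs : IsGevreySummable β c :=
    isGevreySummable_of_isInfraExponential β.coe_nonneg hδ hJ hJc
  -- Makes the separability of `L²` available to instance search, for the rank of negativity.
  have : Fact ((2 : ℝ≥0∞) ≠ ⊤) := ⟨by norm_num⟩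
  refine ⟨indefProdConverges_gelfandShilov hcs, KreinL2, inferInstance, inferInstance,
    inferInstance, kreinForm _ _, kreinEmbedding α hcs,
    isMaximalKreinCompletion_kreinEmbedding hβ hcs hc,
    hasCountablyInfiniteNegativityRank_kreinForm not_finite_lp_two, kreinPos _ _,
    isClosed_kreinPos, maximal_isPosDefOn_kreinPos,
    ⟨⟨isPosDefOn_kreinPos, isSchrodingerInvariant_kreinPos hβ hcs hc⟩,
      fun W hW => le_kreinPos_of_isSchrodingerInvariant hβ.le hcs hc hW.2⟩,
    ⟨kreinMomentum, kreinPosition, isSelfAdjointOperatorOn_kreinMomentum hβ hcs hc,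
      isSelfAdjointOperatorOn_kreinPosition hβ hcs hc, fun f hf =>
        ⟨mem_graph_kreinMomentum hcs hc hf, mem_graph_kreinPosition hcs hc hf⟩⟩,
    fun f => ?_, kreinInl, kreinForm_kreinInl, fun f u hu huf => ?_, ?_⟩
  · rw [kreinEmbedding_mem_kreinPos_iff hcs hc, ← gelfandShilovToL2_mem_fourierLTwoZero_iff]
    constructor
    · exact fun h => ⟨_, h, coeFn_gelfandShilovToL2 f⟩
    · rintro ⟨u, hu, huf⟩
      rwa [← eq_gelfandShilovToL2_of_ae_eq huf]
  · obtain rfl := eq_gelfandShilovToL2_of_ae_eq huf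
    exact (kreinEmbedding_eq_kreinInl hcs hc (gelfandShilovToL2_mem_fourierLTwoZero_iff.1 hu)).symm
  · refine Set.Subset.antisymm (kreinPos_subset_closure_kreinInl dense_fourierLTwoZero)
      (closure_minimal ?_ isClosed_kreinPos)
    rintro _ ⟨u, -, rfl⟩
    exact kreinInl_mem u
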